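/- Let $\mathbb D=\{z\in\mathbb C:|z|<1\}$, $\mathbb D^*=\{z\in\mathbb C:0<|z|<1\}$, $\Omega=\mathbb D\times\mathbb D^*\subset\mathbb C^2$, and let $1\le p<\infty$. For a $(0,1)$-form $f=f_1\,d\bar z_1+f_2\,d\bar z_2$ on $\Omega$ put $$\mathscr D(f)=\tfrac12\left(\frac{\partial f_1}{\partial\bar z_2}+\frac{\partial f_2}{\partial\bar z_1}\right),$$ with derivatives taken in the sense of distributions on $\Omega$. Let $\mathcal B$ be the space of all $f$ with $f_1,f_2,\mathscr D(f)\in L^p(\Omega)$, with norm $\|f\|_{\mathcal B}=\|f_1\|_{L^p(\Omega)}+\|f_2\|_{L^p(\Omega)}+\|\mathscr D(f)\|_{L^p(\Omega)}$. There is a constant $C>0$ such that the following holds for every $f\in\mathcal B$ that is $\bar\partial$-closed on $\Omega$ in the weak sense, that is, $\partial f_1/\partial\bar z_2=\partial f_2/\partial\bar z_1$ as distributions on $\Omega$. The function $$ \begin{aligned} T(f)(z_1,z_2)={}&\frac{-1}{2\pi i}\int_{\mathbb D^*}\frac{f_2(z_1,\zeta_2)}{\zeta_2-z_2}\,d\bar\zeta_2\wedge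 d\zeta_2+\frac{-1}{2\pi i}\int_{\mathbb D}\frac{f_1(\zeta_1,z_2)}{\zeta_1-z_1}\,d\bar\zeta_1\wedge d\zeta_1\\ &+\frac{-1}{(2\pi i)^2}\int_{\mathbb D\times\mathbb D^*}\frac{\mathscr D(f)(\zeta_1,\zeta_2)}{(\zeta_1-z_1)(\zeta_2-z_2)}\,d\bar\zeta_1\wedge d\zeta_1\wedge d\bar\zeta_2\wedge d\zeta_2 \end{aligned} $$ is well defined: the three integrals converge absolutely for almost every $(z_1,z_2)\in\Omega$, and changing $f_1,f_2$ on null sets changes $T(f)$ only on a null set. Moreover $T(f)\in L^p(\Omega)$, $T(f)$ is a weak solution of $\bar\partial(Tf)=f$ on $\Omega$, that is, $\partial T(f)/\partial\bar z_j=f_j$ ($j=1,2$) as distributions on $\Omega$, and $$\|T(f)\|_{L^p(\Omega)}\le C\,\|f\|_{\mathcal B}.$$ -/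

import Mathlib

open MeasureTheory Set
open scoped ENNReal ContDiff

noncomputable section

namespace DbarProduct

/-- The unit disc `𝔻 = {|z| < 1}`. -/
def disc : Set ℂ := {z | ‖z‖ < 1}

/-- The punctured unit disc `𝔻* = {0 < |z| < 1}`. -/
def puncturedDisc : Set ℂ := {z | 0 < ‖z‖ ∧ ‖z‖ < 1}

/-- A `(0,1)`-form `f = f₁ dz̄₁ + f₂ dz̄₂` in two complex variables, given by its coefficient
functions. Only the values of the coefficients on the domain under consideration matter. -/
structure Form01 where
  /-- the coefficient of `dz̄₁` -/
  f₁ : ℂ × ℂ → ℂ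
  /-- the coefficient of `dz̄₂` -/
  f₂ : ℂ × ℂ → ℂ

/-- Test functions on `Ω`: complex valued, smooth, with compact support contained in `Ω`. -/
def IsTestFunction (Ω : Set (ℂ × ℂ)) (φ : ℂ × ℂ → ℂ) : Prop :=
  ContDiff ℝ ∞ φ ∧ HasCompactSupport φ ∧ tsupport φ ⊆ Ω

/-- The Wirtinger derivative `∂φ/∂z̄₁ = (∂φ/∂x₁ + i ∂φ/∂y₁) / 2`. -/
def dbar₁ (φ : ℂ × ℂ → ℂ) (z : ℂ × ℂ) : ℂ :=
  (fderiv ℝ φ z (1, 0) + Complex.I * fderiv ℝ φ z (Complex.I, 0)) / 2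

/-- The Wirtinger derivative `∂φ/∂z̄₂ = (∂φ/∂x₂ + i ∂φ/∂y₂) / 2`. -/
def dbar₂ (φ : ℂ × ℂ → ℂ) (z : ℂ × ℂ) : ℂ :=
  (fderiv ℝ φ z (0, 1) + Complex.I * fderiv ℝ φ z (0, Complex.I)) / 2

/-- Both coefficients of `f` are locally integrable on `Ω` (so that `f` defines distributions). -/
def Form01.LocIntegrableOn (f : Form01) (Ω : Set (ℂ × ℂ)) : Prop :=
  LocallyIntegrableOn f.f₁ Ω ∧ LocallyIntegrableOn f.f₂ Ω

/-- `f` is `∂̄`-closed on `Ω` in the weak sense: `∂f₁/∂z̄₂ = ∂f₂/∂z̄₁` as distributions on `Ω`. -/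
def IsWeaklyDbarClosed (Ω : Set (ℂ × ℂ)) (f : Form01) : Prop :=
  f.LocIntegrableOn Ω ∧ ∀ φ : ℂ × ℂ → ℂ, IsTestFunction Ω φ →
    ∫ z in Ω, f.f₁ z * dbar₂ φ z = ∫ z in Ω, f.f₂ z * dbar₁ φ z

/-- `u` is a weak solution of `∂̄u = f` on `Ω`: `∂u/∂z̄₁ = f₁` and `∂u/∂z̄₂ = f₂` as distributions
on `Ω`. -/
def IsWeakDbarSolution (Ω : Set (ℂ × ℂ)) (u : ℂ × ℂ → ℂ) (f : Form01) : Prop :=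
  LocallyIntegrableOn u Ω ∧ f.LocIntegrableOn Ω ∧ ∀ φ : ℂ × ℂ → ℂ, IsTestFunction Ω φ →
    ∫ z in Ω, u z * dbar₁ φ z = -∫ z in Ω, f.f₁ z * φ z ∧
    ∫ z in Ω, u z * dbar₂ φ z = -∫ z in Ω, f.f₂ z * φ z

/-- The distribution `𝒟(f) = (∂f₁/∂z̄₂ + ∂f₂/∂z̄₁) / 2` on `Ω` is given by the locally integrable
function `g`. -/
def IsScriptD (Ω : Set (ℂ × ℂ)) (f : Form01) (g : ℂ × ℂ → ℂ) : Prop :=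
  f.LocIntegrableOn Ω ∧ LocallyIntegrableOn g Ω ∧ ∀ φ : ℂ × ℂ → ℂ, IsTestFunction Ω φ →
    ∫ z in Ω, g z * φ z =
      -((∫ z in Ω, f.f₁ z * dbar₂ φ z) + ∫ z in Ω, f.f₂ z * dbar₁ φ z) / 2

open scoped Classical in
/-- A function representing the distribution `𝒟(f)` on `Ω`, if there is one (and `0` otherwise).
It is determined up to equality almost everywhere on `Ω`, see `IsScriptD.ae_eq`. -/
def scriptD (Ω : Set (ℂ × ℂ)) (f : Form01) : ℂ × ℂ → ℂ :=
  if h : ∃ g, IsScriptD Ω f g then h.choose else 0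

theorem isScriptD_scriptD {Ω : Set (ℂ × ℂ)} {f : Form01} (h : ∃ g, IsScriptD Ω f g) :
    IsScriptD Ω f (scriptD Ω f) := by
  rw [scriptD, dif_pos h]
  exact h.choose_spec

/-- Two functions representing `𝒟(f)` on the open set `Ω` agree almost everywhere on `Ω`. -/
theorem IsScriptD.ae_eq {Ω : Set (ℂ × ℂ)} (hΩ : IsOpen Ω) {f : Form01} {g h : ℂ × ℂ → ℂ}
    (hg : IsScriptD Ω f g) (hh : IsScriptD Ω f h) : g =ᵐ[volume.restrict Ω] h := by
  have key : ∀ᵐ z, z ∈ Ω → (g - h) z = 0 := by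
    refine hΩ.ae_eq_zero_of_integral_contDiff_smul_eq_zero (hg.2.1.sub hh.2.1) ?_
    intro φ hφ hc hs
    have hsupp : Function.support (fun z => (φ z : ℂ)) = Function.support φ := by
      ext z; simp
    have hts : tsupport (fun z => (φ z : ℂ)) = tsupport φ := by simp only [tsupport, hsupp]
    have ht : IsTestFunction Ω (fun z => (φ z : ℂ)) :=
      ⟨Complex.ofRealCLM.contDiff.comp hφ, by rw [HasCompactSupport, hts]; exact hc, hts ▸ hs⟩
    have hint : ∀ k : ℂ × ℂ → ℂ, LocallyIntegrableOn k Ω →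
        IntegrableOn (fun z => k z * (φ z : ℂ)) Ω := by
      intro k hk
      have h1 : IntegrableOn (fun z => k z * (φ z : ℂ)) (tsupport φ) :=
        (hk.integrableOn_compact_subset hs hc).mul_continuousOn
          (Complex.continuous_ofReal.comp hφ.continuous).continuousOn hc
      have h2 : Integrable (fun z => k z * (φ z : ℂ)) := by
        rwa [integrableOn_iff_integrable_of_support_subset] at h1
        intro z hz
        apply subset_tsupport
        intro h0
        exact hz (by simp [h0])
      exact h2.integrableOn
    have hzero : ∀ z, z ∉ Ω → φ z • (g - h) z = 0 := by
      intro z hz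
      have : φ z = 0 := image_eq_zero_of_notMem_tsupport fun h' => hz (hs h')
      simp [this]
    rw [← setIntegral_eq_integral_of_forall_compl_eq_zero hzero]
    calc ∫ z in Ω, φ z • (g - h) z = ∫ z in Ω, (g z * (φ z : ℂ) - h z * (φ z : ℂ)) := by
          congr 1; ext z; simp [Complex.real_smul]; ring
      _ = 0 := by
          rw [integral_sub (hint g hg.2.1) (hint h hh.2.1), hg.2.2 _ ht, hh.2.2 _ ht, sub_self]
  rw [Filter.EventuallyEq, ae_restrict_iff' hΩ.measurableSet]
  filter_upwards [key] with z hz hzΩ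
  exact sub_eq_zero.mp (hz hzΩ)

/-- Membership in the space `𝓑` on `Ω`: `f₁, f₂ ∈ Lᵖ(Ω)` and `𝒟(f) ∈ Lᵖ(Ω)`. -/
def MemB (p : ℝ≥0∞) (Ω : Set (ℂ × ℂ)) (f : Form01) : Prop :=
  MemLp f.f₁ p (volume.restrict Ω) ∧ MemLp f.f₂ p (volume.restrict Ω) ∧
    ∃ g, IsScriptD Ω f g ∧ MemLp g p (volume.restrict Ω)

/-- The norm `‖f‖_𝓑 = ‖f₁‖_{Lᵖ(Ω)} + ‖f₂‖_{Lᵖ(Ω)} + ‖𝒟(f)‖_{Lᵖ(Ω)}`; it is finite on `𝓑`. -/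
def normB (p : ℝ≥0∞) (Ω : Set (ℂ × ℂ)) (f : Form01) : ℝ≥0∞ :=
  eLpNorm f.f₁ p (volume.restrict Ω) + eLpNorm f.f₂ p (volume.restrict Ω) +
    eLpNorm (scriptD Ω f) p (volume.restrict Ω)

/-- The operator `T` on `D₁ × D₂`. With `dA` Lebesgue measure on `ℂ` we have `dζ̄ ∧ dζ = 2i dA`,
which accounts for the factors `2i` and `(2i)²`. -/
def solT (D₁ D₂ : Set ℂ) (f : Form01) (z : ℂ × ℂ) : ℂ :=
  -1 / (2 * Real.pi * Complex.I) *
      ((2 * Complex.I) * ∫ ζ in D₂, f.f₂ (z.1, ζ) / (ζ - z.2)) +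
    -1 / (2 * Real.pi * Complex.I) *
      ((2 * Complex.I) * ∫ ζ in D₁, f.f₁ (ζ, z.2) / (ζ - z.1)) +
    -1 / (2 * Real.pi * Complex.I) ^ 2 *
      ((2 * Complex.I) ^ 2 *
        ∫ ζ in D₁ ×ˢ D₂, scriptD (D₁ ×ˢ D₂) f ζ / ((ζ.1 - z.1) * (ζ.2 - z.2)))

/-- The three integrals in the formula for `Tf` at the point `z` converge absolutely. -/
def SolTConvergesAt (D₁ D₂ : Set ℂ) (f : Form01) (z : ℂ × ℂ) : Prop :=
  IntegrableOn (fun ζ : ℂ => f.f₂ (z.1, ζ) / (ζ - z.2)) D₂ ∧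
    IntegrableOn (fun ζ : ℂ => f.f₁ (ζ, z.2) / (ζ - z.1)) D₁ ∧
    IntegrableOn (fun ζ : ℂ × ℂ =>
      scriptD (D₁ ×ˢ D₂) f ζ / ((ζ.1 - z.1) * (ζ.2 - z.2))) (D₁ ×ˢ D₂)

end DbarProduct

end

/-!
By the Cauchy–Pompeiu formula, `∂̄` of the Cauchy transform of `u` is `-π u`, so each one-variable
transform in `T` solves its own equation, `∂Tf/∂z̄₁ = f₁` or `∂Tf/∂z̄₂ = f₂`, up to an error coming
from the other one. Since `f` is closed, `𝒟(f)` is the common value of `∂f₁/∂z̄₂` and `∂f₂/∂z̄₁`;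
hence the error is a one-variable transform of `𝒟(f)`, and the double transform of `𝒟(f)` cancels
it.

The kernel `1 / |ζ - z|` has uniformly bounded mass on a set of finite area, so the transforms are
bounded on every `Lᵖ` by the Schur test, and Fubini moves them onto the test functions.
-/

noncomputable section

namespace DbarProduct

open scoped Real

section CauchyPompeiu

open Complex Metric Function ComplexConjugate

/-! ### The Cauchy–Pompeiu formula -/

/-- The Wirtinger derivative `∂ψ/∂z̄` in one variable. -/
def dbar (ψ : ℂ → ℂ) (z : ℂ) : ℂ :=
  (fderiv ℝ ψ z 1 + I * fderiv ℝ ψ z I) / 2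

lemma map_add_I_mul_map_I_mul (L : ℂ →L[ℝ] ℂ) (w : ℂ) :
    L w + I * L (I * w) = conj w * (L 1 + I * L I) := by
  have hw : w = w.re • (1 : ℂ) + w.im • I := by simp
  have hIw : I * w = (-w.im) • (1 : ℂ) + w.re • I := by apply Complex.ext <;> simp
  have hconj : conj w = w.re - w.im * I := by apply Complex.ext <;> simp
  rw [hIw, hconj]
  nth_rewrite 1 [hw]
  simp only [map_add, map_smul]
  simp only [real_smul, ofReal_neg]
  linear_combination (w.im * L I) * I_sq

lemma fderiv_eq_zero_of_notMem_tsupport {E F : Type*} [NormedAddCommGroup E] [NormedSpace ℝ E]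
    [NormedAddCommGroup F] [NormedSpace ℝ F] {φ : E → F} {x : E} (hx : x ∉ tsupport φ) :
    fderiv ℝ φ x = 0 :=
  image_eq_zero_of_notMem_tsupport fun h => hx (tsupport_fderiv_subset ℝ h)

lemma integral_Ioi_fderiv_smul {E F : Type*} [NormedAddCommGroup E] [NormedSpace ℝ E]
    [NormedAddCommGroup F] [NormedSpace ℝ F] [CompleteSpace F] {φ : E → F}
    (hφ : ContDiff ℝ 1 φ) (hc : HasCompactSupport φ) {v : E} (hv : v ≠ 0) :
    ∫ r in Ioi (0 : ℝ), fderiv ℝ φ (r • v) v = -φ 0 := by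
  have hderiv : ∀ r : ℝ, deriv (fun r : ℝ => φ (r • v)) r = fderiv ℝ φ (r • v) v := fun r =>
    ((hφ.differentiable one_ne_zero _).hasFDerivAt.comp_hasDerivAt r
      (by simpa using (hasDerivAt_id r).smul_const v)).deriv
  have h := HasCompactSupport.integral_Ioi_deriv_eq (f := fun r : ℝ => φ (r • v))
    (hφ.comp (contDiff_id.smul contDiff_const))
    (hc.comp_isClosedEmbedding (isClosedEmbedding_smul_left hv)) 0
  simpa only [hderiv, zero_smul] using h

lemma integral_fderiv_mul_exp_I_mul {F : Type*} [NormedAddCommGroup F] [NormedSpace ℝ F]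
    [CompleteSpace F] {φ : ℂ → F} (hφ : ContDiff ℝ 1 φ) {r : ℝ} (hr : r ≠ 0) :
    ∫ θ in -π..π, fderiv ℝ φ (r * exp (θ * I)) (I * exp (θ * I)) = 0 := by
  have hcurve : ∀ θ : ℝ, HasDerivAt (fun θ : ℝ => (r * exp (θ * I) : ℂ))
      (r • (I * exp (θ * I))) θ := fun θ => by
    have hI : HasDerivAt (fun θ : ℝ => (θ * I : ℂ)) I θ := by
      simpa using (ofRealCLM.hasDerivAt (x := θ)).mul_const I
    simpa only [real_smul, mul_comm I] using hI.cexp.const_mul (r : ℂ)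
  have hderiv : ∀ θ : ℝ, HasDerivAt (fun θ : ℝ => φ (r * exp (θ * I)))
      (r • fderiv ℝ φ (r * exp (θ * I)) (I * exp (θ * I))) θ := fun θ => by
    rw [← map_smul]
    exact (hφ.differentiable one_ne_zero _).hasFDerivAt.comp_hasDerivAt θ (hcurve θ)
  have hcont : Continuous (fun θ : ℝ => r • fderiv ℝ φ (r * exp (θ * I)) (I * exp (θ * I))) :=
    (((hφ.continuous_fderiv one_ne_zero).comp (by fun_prop)).clm_apply
      (by fun_prop)).const_smul r
  have hperiod : exp (π * I) = exp ((-π : ℝ) * I) := by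
    rw [exp_pi_mul_I, ofReal_neg, neg_mul, exp_neg, exp_pi_mul_I, inv_neg, inv_one]
  have h := intervalIntegral.integral_eq_sub_of_hasDerivAt (fun θ _ => hderiv θ)
    (hcont.intervalIntegrable (-π) π)
  rw [hperiod, sub_self, intervalIntegral.integral_smul] at h
  exact (smul_eq_zero.1 h).resolve_left hr

lemma integrableOn_fderiv_polar {F : Type*} [NormedAddCommGroup F] [NormedSpace ℝ F] {φ : ℂ → F}
    (hφ : ContDiff ℝ 1 φ) (hc : HasCompactSupport φ) (c : ℂ) :
    IntegrableOn (fun q : ℝ × ℝ => fderiv ℝ φ (q.1 * exp (q.2 * I)) (c * exp (q.2 * I)))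
      (Ioi 0 ×ˢ Ioo (-π) π) := by
  obtain ⟨R, hR⟩ : ∃ R : ℝ, tsupport φ ⊆ ball 0 R := hc.isBounded.subset_ball 0
  have hcont : Continuous fun q : ℝ × ℝ =>
      fderiv ℝ φ (q.1 * exp (q.2 * I)) (c * exp (q.2 * I)) :=
    ((hφ.continuous_fderiv one_ne_zero).comp (by fun_prop)).clm_apply (by fun_prop)
  refine (hcont.continuousOn.integrableOn_compact
    ((isCompact_Icc (a := 0) (b := R)).prod (isCompact_Icc (a := -π) (b := π)))
    ).of_forall_sdiff_eq_zero (measurableSet_Ioi.prod measurableSet_Ioo) ?_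
  rintro ⟨r, θ⟩ ⟨⟨hr, hθ⟩, hout⟩
  have hRr : R < r := not_le.1 fun h => hout ⟨⟨le_of_lt hr, h⟩, Ioo_subset_Icc_self hθ⟩
  have hmem : (r * exp (θ * I) : ℂ) ∉ tsupport φ := fun h => by
    have hlt := hR h
    rw [mem_ball_zero_iff, norm_mul, norm_exp_ofReal_mul_I, mul_one, norm_real,
      Real.norm_of_nonneg (le_of_lt hr)] at hlt
    exact hlt.not_gt hRr
  simp only [fderiv_eq_zero_of_notMem_tsupport hmem, zero_apply]

lemma smul_dbar_div_polar (φ : ℂ → ℂ) {r : ℝ} (hr : r ≠ 0) (θ : ℝ) :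
    r • (dbar φ (r * exp (θ * I)) / (r * exp (θ * I))) =
      (1 / 2 : ℂ) * (fderiv ℝ φ (r * exp (θ * I)) (1 * exp (θ * I)) +
        I * fderiv ℝ φ (r * exp (θ * I)) (I * exp (θ * I))) := by
  have hinv : (exp (θ * I))⁻¹ = conj (exp (θ * I)) := by
    rw [← exp_neg, ← exp_conj, map_mul, conj_ofReal, conj_I, mul_neg]
  have hr' : (r : ℂ) ≠ 0 := ofReal_ne_zero.2 hr
  rw [one_mul, map_add_I_mul_map_I_mul, ← hinv, dbar, real_smul]
  field_simp

lemma integral_dbar_div {φ : ℂ → ℂ} (hφ : ContDiff ℝ 1 φ) (hc : HasCompactSupport φ) :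
    ∫ z, dbar φ z / z = -(π * φ 0) := by
  have h_int := integrableOn_fderiv_polar hφ hc
  have hradial : ∫ q in Ioi (0 : ℝ) ×ˢ Ioo (-π) π,
      fderiv ℝ φ (q.1 * exp (q.2 * I)) (1 * exp (q.2 * I)) = -(2 * π * φ 0) := by
    rw [Measure.volume_eq_prod, ← setIntegral_prod_swap]
    calc _ = ∫ θ in Ioo (-π) π, ∫ r in Ioi (0 : ℝ), fderiv ℝ φ (r • exp (θ * I)) (exp (θ * I)) := by
          simpa only [one_mul, real_smul] using! setIntegral_prod _ (h_int 1).swap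
      _ = ∫ _ in Ioo (-π) π, -φ 0 := by
          simp only [integral_Ioi_fderiv_smul hφ hc (exp_ne_zero _)]
      _ = -(2 * π * φ 0) := by
          rw [setIntegral_const, Real.volume_real_Ioo_of_le (neg_le_self Real.pi_pos.le), real_smul]
          push_cast
          ring
  have hangular : ∫ q in Ioi (0 : ℝ) ×ˢ Ioo (-π) π,
      fderiv ℝ φ (q.1 * exp (q.2 * I)) (I * exp (q.2 * I)) = 0 := by
    rw [Measure.volume_eq_prod, setIntegral_prod _ (h_int I)]
    refine setIntegral_eq_zero_of_forall_eq_zero fun r hr => ?_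
    rw [← integral_Ioc_eq_integral_Ioo,
      ← intervalIntegral.integral_of_le (by linarith [Real.pi_pos])]
    exact integral_fderiv_mul_exp_I_mul hφ hr.ne'
  rw [← Complex.integral_comp_polarCoord_symm]
  calc _ = ∫ q in Ioi (0 : ℝ) ×ˢ Ioo (-π) π, (1 / 2 : ℂ) *
        (fderiv ℝ φ (q.1 * exp (q.2 * I)) (1 * exp (q.2 * I)) +
          I * fderiv ℝ φ (q.1 * exp (q.2 * I)) (I * exp (q.2 * I))) := by
        refine setIntegral_congr_fun polarCoord.open_target.measurableSet fun q hq => ?_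
        rw [← smul_dbar_div_polar φ hq.1.ne', exp_mul_I, ← ofReal_cos, ← ofReal_sin,
          Complex.polarCoord_symm_apply]
    _ = -(π * φ 0) := by
        rw [integral_const_mul, integral_add (h_int 1) ((h_int I).const_mul _), integral_const_mul,
          hradial, hangular]
        ring

lemma integral_dbar_div_sub {φ : ℂ → ℂ} (hφ : ContDiff ℝ 1 φ) (hc : HasCompactSupport φ) (w : ℂ) :
    ∫ z, dbar φ z / (w - z) = π * φ w := by
  have h := integral_dbar_div (φ := fun z => φ (z + w)) (hφ.comp (by fun_prop))
    (hc.comp_homeomorph (Homeomorph.addRight w))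
  simp only [dbar, fderiv_comp_add_right, zero_add] at h
  rw [← integral_add_right_eq_self _ w, ← neg_neg (π * φ w : ℂ), ← h, ← integral_neg]
  simp only [dbar, sub_add_cancel_right, div_neg]

/-! ### The Cauchy kernel -/

/-- The largest mass that the Cauchy kernel `1 / |ζ - z|` with a pole `z` carries for `μ`. It is
the norm bound for the Cauchy transforms on every `Lᵖ`. -/
def cauchyMass (μ : Measure ℂ) : ℝ≥0∞ :=
  ⨆ z, ∫⁻ ζ, ‖(ζ - z)⁻¹‖ₑ ∂μ

lemma lintegral_enorm_inv_sub_le (μ : Measure ℂ) (z : ℂ) :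
    ∫⁻ ζ, ‖(ζ - z)⁻¹‖ₑ ∂μ ≤ cauchyMass μ :=
  le_iSup (fun z => ∫⁻ ζ, ‖(ζ - z)⁻¹‖ₑ ∂μ) z

lemma lintegral_enorm_inv_sub_le' (μ : Measure ℂ) (ζ : ℂ) :
    ∫⁻ z, ‖(ζ - z)⁻¹‖ₑ ∂μ ≤ cauchyMass μ := by
  refine le_of_eq_of_le (lintegral_congr fun z => ?_) (lintegral_enorm_inv_sub_le μ ζ)
  rw [← neg_sub, inv_neg, enorm_neg]

lemma lintegral_ball_enorm_inv_lt_top (R : ℝ) : ∫⁻ w in ball (0 : ℂ) R, ‖w⁻¹‖ₑ < ⊤ := by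
  have h : IntegrableOn (fun w : ℂ => ‖w‖⁻¹) (ball 0 R) := by
    rw [integrableOn_fun_norm_addHaar volume (f := fun r => r⁻¹)]
    refine (integrableOn_const (C := (1 : ℝ)) (by simp)).congr_fun (fun r hr => ?_)
      measurableSet_Ioo
    simp [hr.1.ne']
  simpa only [HasFiniteIntegral, enorm_norm, ← norm_inv] using h.2

lemma cauchyMass_restrict_ne_top {D : Set ℂ} (hD : volume D ≠ ⊤) :
    cauchyMass (volume.restrict D) ≠ ⊤ := by
  have hbound : ∀ z : ℂ, ∫⁻ ζ in D, ‖(ζ - z)⁻¹‖ₑ ≤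
      (∫⁻ w in ball (0 : ℂ) 1, ‖w⁻¹‖ₑ) + volume D := fun z => by
    have hsplit : ∀ ζ : ℂ, ‖(ζ - z)⁻¹‖ₑ ≤
        (ball (0 : ℂ) 1).indicator (fun w => ‖w⁻¹‖ₑ) (ζ - z) + 1 := fun ζ => by
      by_cases h : ζ - z ∈ ball (0 : ℂ) 1
      · rw [indicator_of_mem h]
        exact le_self_add
      · rw [indicator_of_notMem h, zero_add, ← ofReal_norm, ENNReal.ofReal_le_one, norm_inv]
        exact inv_le_one_of_one_le₀ (by simpa using h)
    calc ∫⁻ ζ in D, ‖(ζ - z)⁻¹‖ₑ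
        ≤ ∫⁻ ζ in D, ((ball (0 : ℂ) 1).indicator (fun w => ‖w⁻¹‖ₑ) (ζ - z) + 1) :=
          lintegral_mono hsplit
      _ = (∫⁻ ζ in D, (ball (0 : ℂ) 1).indicator (fun w => ‖w⁻¹‖ₑ) (ζ - z)) + volume D := by
          rw [lintegral_add_right _ measurable_const, setLIntegral_one]
      _ ≤ (∫⁻ ζ, (ball (0 : ℂ) 1).indicator (fun w => ‖w⁻¹‖ₑ) (ζ - z)) + volume D := by
          exact add_le_add_left (setLIntegral_le_lintegral _ _) _
      _ = (∫⁻ w in ball (0 : ℂ) 1, ‖w⁻¹‖ₑ) + volume D := by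
          rw [lintegral_sub_right_eq_self ((ball (0 : ℂ) 1).indicator fun w => ‖w⁻¹‖ₑ),
            lintegral_indicator measurableSet_ball]
  exact ((iSup_le hbound).trans_lt
    (ENNReal.add_lt_top.2 ⟨lintegral_ball_enorm_inv_lt_top 1, hD.lt_top⟩)).ne

end CauchyPompeiu

lemma rpow_lintegral_mul_le {α : Type*} [MeasurableSpace α] {μ : Measure α} {g k : α → ℝ≥0∞}
    (hg : AEMeasurable g μ) (hk : AEMeasurable k μ) {q : ℝ} (hq : 1 ≤ q) :
    (∫⁻ a, g a * k a ∂μ) ^ q ≤ (∫⁻ a, k a ∂μ) ^ (q - 1) * ∫⁻ a, g a ^ q * k a ∂μ := by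
  have hq0 : 0 < q := by linarith
  have hq1 : 0 ≤ 1 - 1 / q := sub_nonneg.2 ((div_le_one hq0).2 hq)
  have hsplit : ∀ a, k a ^ (1 - 1 / q) * (g a ^ q * k a) ^ (1 / q) = g a * k a := fun a => by
    rw [ENNReal.mul_rpow_of_nonneg _ _ (by positivity), ← ENNReal.rpow_mul,
      mul_one_div_cancel hq0.ne', ENNReal.rpow_one, mul_left_comm,
      ← ENNReal.rpow_add_of_nonneg _ _ hq1 (by positivity), sub_add_cancel, ENNReal.rpow_one]
  have holder := ENNReal.lintegral_mul_norm_pow_le hk ((hg.pow_const q).mul hk) hq1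
    (by positivity : 0 ≤ 1 / q) (by ring)
  simp only [Pi.mul_apply, hsplit] at holder
  calc (∫⁻ a, g a * k a ∂μ) ^ q
      ≤ ((∫⁻ a, k a ∂μ) ^ (1 - 1 / q) * (∫⁻ a, g a ^ q * k a ∂μ) ^ (1 / q)) ^ q := by gcongr
    _ = (∫⁻ a, k a ∂μ) ^ (q - 1) * ∫⁻ a, g a ^ q * k a ∂μ := by
      rw [ENNReal.mul_rpow_of_nonneg _ _ hq0.le, ← ENNReal.rpow_mul, ← ENNReal.rpow_mul,
        one_div_mul_cancel hq0.ne', ENNReal.rpow_one, sub_mul, one_mul,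
        one_div_mul_cancel hq0.ne']

/-! ### Partial Cauchy transforms -/

/-- The Cauchy transform in the first variable of a function of `(ζ, y) ∈ ℂ × Y`. -/
def cauchyFst {Y : Type*} (μ : Measure ℂ) (F : ℂ × Y → ℂ) (z : ℂ × Y) : ℂ :=
  ∫ ζ, F (ζ, z.2) / (ζ - z.1) ∂μ

/-- The Cauchy transform in the second variable of a function of `(x, ζ) ∈ X × ℂ`. -/
def cauchySnd {X : Type*} (ν : Measure ℂ) (F : X × ℂ → ℂ) (z : X × ℂ) : ℂ :=
  ∫ ζ, F (z.1, ζ) / (ζ - z.2) ∂ν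

lemma enorm_cauchyFst_le {Y : Type*} (μ : Measure ℂ) (F : ℂ × Y → ℂ) (z : ℂ × Y) :
    ‖cauchyFst μ F z‖ₑ ≤ ∫⁻ ζ, ‖F (ζ, z.2)‖ₑ * ‖(ζ - z.1)⁻¹‖ₑ ∂μ := by
  simpa only [cauchyFst, div_eq_mul_inv, enorm_mul] using
    enorm_integral_le_lintegral_enorm fun ζ => F (ζ, z.2) / (ζ - z.1)

section CauchyFst

variable {Y : Type*} [MeasurableSpace Y] {μ : Measure ℂ} {ν : Measure Y} [SFinite μ] [SFinite ν]
  {F G : ℂ × Y → ℂ}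

/-- The symmetry behind Fubini for the Cauchy transform: it swaps the pole with the variable of
integration. -/
lemma measurePreserving_exchange (μ : Measure ℂ) (ν : Measure Y) [SFinite μ] [SFinite ν] :
    MeasurePreserving (fun q : (ℂ × Y) × ℂ => ((q.2, q.1.2), q.1.1))
      ((μ.prod ν).prod μ) ((μ.prod ν).prod μ) :=
  ((Measure.measurePreserving_swap.prod (MeasurePreserving.id μ)).comp
    (Measure.measurePreserving_swap (μ := μ) (ν := ν.prod μ))).comp
    (measurePreserving_prodAssoc μ ν μ)

lemma quasiMeasurePreserving_source (μ : Measure ℂ) (ν : Measure Y) [SFinite μ] [SFinite ν] :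
    Measure.QuasiMeasurePreserving (fun q : (ℂ × Y) × ℂ => (q.2, q.1.2))
      ((μ.prod ν).prod μ) (μ.prod ν) :=
  Measure.quasiMeasurePreserving_fst.comp (measurePreserving_exchange μ ν).quasiMeasurePreserving

lemma lintegral_mul_enorm_inv_sub_le {h : ℂ × Y → ℝ≥0∞} (hh : AEMeasurable h (μ.prod ν)) :
    ∫⁻ q, h (q.2, q.1.2) * ‖(q.2 - q.1.1)⁻¹‖ₑ ∂((μ.prod ν).prod μ)
      ≤ cauchyMass μ * ∫⁻ w, h w ∂(μ.prod ν) := by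
  have hmp := measurePreserving_exchange μ ν
  have hmeas : AEMeasurable (fun q : (ℂ × Y) × ℂ => h q.1 * ‖(q.1.1 - q.2)⁻¹‖ₑ)
      ((μ.prod ν).prod μ) :=
    (hh.comp_quasiMeasurePreserving Measure.quasiMeasurePreserving_fst).mul (by fun_prop)
  calc ∫⁻ q, h (q.2, q.1.2) * ‖(q.2 - q.1.1)⁻¹‖ₑ ∂((μ.prod ν).prod μ)
      = ∫⁻ q, h q.1 * ‖(q.1.1 - q.2)⁻¹‖ₑ ∂((μ.prod ν).prod μ) := by
        conv_rhs => rw [← hmp.map_eq]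
        rw [lintegral_map' (by rwa [hmp.map_eq]) hmp.measurable.aemeasurable]
    _ = ∫⁻ w, h w * ∫⁻ z, ‖(w.1 - z)⁻¹‖ₑ ∂μ ∂(μ.prod ν) := by
        rw [lintegral_prod _ hmeas]
        refine lintegral_congr fun w => ?_
        rw [← lintegral_const_mul _ (by fun_prop)]
    _ ≤ ∫⁻ w, h w * cauchyMass μ ∂(μ.prod ν) := by
        gcongr with w
        exact lintegral_enorm_inv_sub_le' μ _
    _ = cauchyMass μ * ∫⁻ w, h w ∂(μ.prod ν) := by
        rw [lintegral_mul_const'' _ hh, mul_comm]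

lemma aestronglyMeasurable_cauchyFst_integrand (hF : AEStronglyMeasurable F (μ.prod ν)) :
    AEStronglyMeasurable (fun q : (ℂ × Y) × ℂ => F (q.2, q.1.2) / (q.2 - q.1.1))
      ((μ.prod ν).prod μ) := by
  simp only [div_eq_mul_inv]
  exact (hF.comp_quasiMeasurePreserving (quasiMeasurePreserving_source μ ν)).mul
    (Measurable.aestronglyMeasurable (by fun_prop))

lemma integrable_cauchyFst_integrand (hμ : cauchyMass μ ≠ ⊤) (hF : Integrable F (μ.prod ν)) :
    Integrable (fun q : (ℂ × Y) × ℂ => F (q.2, q.1.2) / (q.2 - q.1.1)) ((μ.prod ν).prod μ) := by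
  refine ⟨aestronglyMeasurable_cauchyFst_integrand hF.1, ?_⟩
  rw [hasFiniteIntegral_iff_enorm]
  simp only [div_eq_mul_inv, enorm_mul]
  exact (lintegral_mul_enorm_inv_sub_le hF.1.enorm).trans_lt (ENNReal.mul_lt_top hμ.lt_top hF.2)

lemma ae_integrable_cauchyFst_integrand (hμ : cauchyMass μ ≠ ⊤) (hF : Integrable F (μ.prod ν)) :
    ∀ᵐ z ∂(μ.prod ν), Integrable (fun ζ => F (ζ, z.2) / (ζ - z.1)) μ :=
  (integrable_cauchyFst_integrand hμ hF).prod_right_ae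

lemma aestronglyMeasurable_cauchyFst (hF : AEStronglyMeasurable F (μ.prod ν)) :
    AEStronglyMeasurable (cauchyFst μ F) (μ.prod ν) :=
  (aestronglyMeasurable_cauchyFst_integrand hF).integral_prod_right'

lemma cauchyFst_congr_ae (h : F =ᵐ[μ.prod ν] G) : cauchyFst μ F =ᵐ[μ.prod ν] cauchyFst μ G := by
  filter_upwards [Measure.ae_ae_of_ae_prod ((quasiMeasurePreserving_source μ ν).ae h)] with z hz
  refine integral_congr_ae ?_
  filter_upwards [hz] with ζ hζ
  rw [hζ]

lemma integrable_cauchyFst (hμ : cauchyMass μ ≠ ⊤) (hF : Integrable F (μ.prod ν)) :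
    Integrable (cauchyFst μ F) (μ.prod ν) :=
  (integrable_cauchyFst_integrand hμ hF).integral_prod_left

lemma lintegral_enorm_cauchyFst_rpow_le {q : ℝ} (hq : 1 ≤ q)
    (hF : AEStronglyMeasurable F (μ.prod ν)) :
    ∫⁻ z, ‖cauchyFst μ F z‖ₑ ^ q ∂(μ.prod ν) ≤
      cauchyMass μ ^ q * ∫⁻ w, ‖F w‖ₑ ^ q ∂(μ.prod ν) := by
  have hsource := hF.comp_quasiMeasurePreserving (quasiMeasurePreserving_source μ ν)
  have hmeas : AEMeasurable (fun q' : (ℂ × Y) × ℂ =>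
      ‖F (q'.2, q'.1.2)‖ₑ ^ q * ‖(q'.2 - q'.1.1)⁻¹‖ₑ) ((μ.prod ν).prod μ) :=
    (hsource.enorm.pow_const q).mul (by fun_prop)
  have hpointwise : ∀ᵐ z ∂(μ.prod ν), ‖cauchyFst μ F z‖ₑ ^ q ≤
      cauchyMass μ ^ (q - 1) * ∫⁻ ζ, ‖F (ζ, z.2)‖ₑ ^ q * ‖(ζ - z.1)⁻¹‖ₑ ∂μ := by
    filter_upwards [hsource.prodMk_left] with z hz
    simp only [Function.comp_def] at hz
    calc ‖cauchyFst μ F z‖ₑ ^ q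
        ≤ (∫⁻ ζ, ‖F (ζ, z.2)‖ₑ * ‖(ζ - z.1)⁻¹‖ₑ ∂μ) ^ q := by
          gcongr
          exact enorm_cauchyFst_le μ F z
      _ ≤ _ := rpow_lintegral_mul_le hz.enorm (by fun_prop) hq
      _ ≤ _ := by
          gcongr
          exact lintegral_enorm_inv_sub_le μ _
  calc ∫⁻ z, ‖cauchyFst μ F z‖ₑ ^ q ∂(μ.prod ν)
      ≤ ∫⁻ z, cauchyMass μ ^ (q - 1) *
          ∫⁻ ζ, ‖F (ζ, z.2)‖ₑ ^ q * ‖(ζ - z.1)⁻¹‖ₑ ∂μ ∂(μ.prod ν) := lintegral_mono_ae hpointwise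
    _ = cauchyMass μ ^ (q - 1) * ∫⁻ q', ‖F (q'.2, q'.1.2)‖ₑ ^ q * ‖(q'.2 - q'.1.1)⁻¹‖ₑ
          ∂((μ.prod ν).prod μ) := by
        rw [lintegral_const_mul'' _ hmeas.lintegral_prod_right', lintegral_prod _ hmeas]
    _ ≤ cauchyMass μ ^ (q - 1) * (cauchyMass μ * ∫⁻ w, ‖F w‖ₑ ^ q ∂(μ.prod ν)) := by
        gcongr
        exact lintegral_mul_enorm_inv_sub_le (hF.enorm.pow_const q)
    _ = cauchyMass μ ^ q * ∫⁻ w, ‖F w‖ₑ ^ q ∂(μ.prod ν) := by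
        rw [← mul_assoc]
        nth_rewrite 2 [← ENNReal.rpow_one (cauchyMass μ)]
        rw [← ENNReal.rpow_add_of_nonneg _ _ (by linarith) zero_le_one, sub_add_cancel]

lemma eLpNormEssSup_cauchyFst_le (F : ℂ × Y → ℂ) :
    eLpNormEssSup (cauchyFst μ F) (μ.prod ν) ≤ cauchyMass μ * eLpNormEssSup F (μ.prod ν) := by
  refine eLpNormEssSup_le_of_ae_enorm_bound ?_
  filter_upwards [Measure.ae_ae_of_ae_prod ((quasiMeasurePreserving_source μ ν).ae
    (enorm_ae_le_eLpNormEssSup F (μ.prod ν)))] with z hz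
  calc ‖cauchyFst μ F z‖ₑ ≤ ∫⁻ ζ, ‖F (ζ, z.2)‖ₑ * ‖(ζ - z.1)⁻¹‖ₑ ∂μ := enorm_cauchyFst_le μ F z
    _ ≤ ∫⁻ ζ, eLpNormEssSup F (μ.prod ν) * ‖(ζ - z.1)⁻¹‖ₑ ∂μ :=
        lintegral_mono_ae (hz.mono fun ζ hζ => by gcongr)
    _ = (∫⁻ ζ, ‖(ζ - z.1)⁻¹‖ₑ ∂μ) * eLpNormEssSup F (μ.prod ν) := by
        rw [lintegral_const_mul _ (by fun_prop), mul_comm]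
    _ ≤ cauchyMass μ * eLpNormEssSup F (μ.prod ν) := by
        gcongr
        exact lintegral_enorm_inv_sub_le μ _

lemma eLpNorm_cauchyFst_le {p : ℝ≥0∞} (hp : 1 ≤ p) (hF : AEStronglyMeasurable F (μ.prod ν)) :
    eLpNorm (cauchyFst μ F) p (μ.prod ν) ≤ cauchyMass μ * eLpNorm F p (μ.prod ν) := by
  rcases eq_or_ne p ⊤ with rfl | hp'
  · simpa only [eLpNorm_exponent_top] using eLpNormEssSup_cauchyFst_le F
  have hp0 : p ≠ 0 := (zero_lt_one.trans_le hp).ne'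
  have hq : 1 ≤ p.toReal := by simpa using ENNReal.toReal_mono hp' hp
  rw [eLpNorm_eq_lintegral_rpow_enorm_toReal hp0 hp',
    eLpNorm_eq_lintegral_rpow_enorm_toReal hp0 hp']
  calc (∫⁻ z, ‖cauchyFst μ F z‖ₑ ^ p.toReal ∂(μ.prod ν)) ^ (1 / p.toReal)
      ≤ (cauchyMass μ ^ p.toReal * ∫⁻ w, ‖F w‖ₑ ^ p.toReal ∂(μ.prod ν)) ^ (1 / p.toReal) := by
        gcongr
        exact lintegral_enorm_cauchyFst_rpow_le hq hF
    _ = cauchyMass μ * (∫⁻ w, ‖F w‖ₑ ^ p.toReal ∂(μ.prod ν)) ^ (1 / p.toReal) := by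
        rw [ENNReal.mul_rpow_of_nonneg _ _ (by positivity), ← ENNReal.rpow_mul,
          mul_one_div_cancel (by positivity), ENNReal.rpow_one]

lemma integral_cauchyFst_mul (hμ : cauchyMass μ ≠ ⊤) (hF : Integrable F (μ.prod ν))
    {Φ : ℂ × Y → ℂ} (hΦ : AEStronglyMeasurable Φ (μ.prod ν)) {M : ℝ} (hM : ∀ z, ‖Φ z‖ ≤ M) :
    ∫ z, cauchyFst μ F z * Φ z ∂(μ.prod ν) = -∫ w, F w * cauchyFst μ Φ w ∂(μ.prod ν) := by
  have hmp := measurePreserving_exchange μ ν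
  have h_int : Integrable (fun q : (ℂ × Y) × ℂ => F (q.2, q.1.2) / (q.2 - q.1.1) * Φ q.1)
      ((μ.prod ν).prod μ) :=
    (integrable_cauchyFst_integrand hμ hF).mul_bdd hΦ.comp_fst (.of_forall fun q => hM _)
  have h_int' : Integrable (fun q : (ℂ × Y) × ℂ => F q.1 / (q.1.1 - q.2) * Φ (q.2, q.1.2))
      ((μ.prod ν).prod μ) := hmp.integrable_comp_of_integrable h_int
  calc ∫ z, cauchyFst μ F z * Φ z ∂(μ.prod ν)
      = ∫ z, ∫ ζ, F (ζ, z.2) / (ζ - z.1) * Φ z ∂μ ∂(μ.prod ν) := by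
        simp only [cauchyFst, integral_mul_const]
    _ = ∫ q, F (q.2, q.1.2) / (q.2 - q.1.1) * Φ q.1 ∂((μ.prod ν).prod μ) :=
        (integral_prod _ h_int).symm
    _ = ∫ q, F q.1 / (q.1.1 - q.2) * Φ (q.2, q.1.2) ∂((μ.prod ν).prod μ) := by
        conv_rhs => rw [← hmp.map_eq]
        rw [integral_map hmp.measurable.aemeasurable (by rw [hmp.map_eq]; exact h_int'.1)]
    _ = ∫ w, ∫ z, F w / (w.1 - z) * Φ (z, w.2) ∂μ ∂(μ.prod ν) := integral_prod _ h_int'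
    _ = -∫ w, F w * cauchyFst μ Φ w ∂(μ.prod ν) := by
        rw [← integral_neg]
        congr with w
        rw [cauchyFst, ← integral_const_mul, ← integral_neg]
        congr with z
        rw [← neg_sub z w.1, div_neg]
        ring

end CauchyFst

section CauchySnd

variable {X : Type*} [MeasurableSpace X] {μ : Measure X} {ν : Measure ℂ} [SFinite μ] [SFinite ν]
  {F G : X × ℂ → ℂ}

lemma ae_integrable_cauchySnd_integrand (hν : cauchyMass ν ≠ ⊤) (hF : Integrable F (μ.prod ν)) :
    ∀ᵐ z ∂(μ.prod ν), Integrable (fun ζ => F (z.1, ζ) / (ζ - z.2)) ν :=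
  Measure.measurePreserving_swap.quasiMeasurePreserving.ae
    (ae_integrable_cauchyFst_integrand hν hF.swap)

lemma aestronglyMeasurable_cauchySnd (hF : AEStronglyMeasurable F (μ.prod ν)) :
    AEStronglyMeasurable (cauchySnd ν F) (μ.prod ν) :=
  (aestronglyMeasurable_cauchyFst hF.prod_swap).prod_swap

lemma cauchySnd_congr_ae (h : F =ᵐ[μ.prod ν] G) : cauchySnd ν F =ᵐ[μ.prod ν] cauchySnd ν G :=
  Measure.measurePreserving_swap.quasiMeasurePreserving.ae_eq_comp
    (cauchyFst_congr_ae (Measure.measurePreserving_swap.quasiMeasurePreserving.ae_eq_comp h))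

lemma integrable_cauchySnd (hν : cauchyMass ν ≠ ⊤) (hF : Integrable F (μ.prod ν)) :
    Integrable (cauchySnd ν F) (μ.prod ν) :=
  (integrable_cauchyFst hν hF.swap).swap

lemma eLpNorm_cauchySnd_le {p : ℝ≥0∞} (hp : 1 ≤ p) (hF : AEStronglyMeasurable F (μ.prod ν)) :
    eLpNorm (cauchySnd ν F) p (μ.prod ν) ≤ cauchyMass ν * eLpNorm F p (μ.prod ν) := by
  rw [← eLpNorm_comp_measurePreserving hF (Measure.measurePreserving_swap (μ := ν) (ν := μ))]
  exact (eLpNorm_comp_measurePreserving (aestronglyMeasurable_cauchyFst hF.prod_swap)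
    Measure.measurePreserving_swap).trans_le (eLpNorm_cauchyFst_le hp hF.prod_swap)

lemma integral_cauchySnd_mul (hν : cauchyMass ν ≠ ⊤) (hF : Integrable F (μ.prod ν))
    {Φ : X × ℂ → ℂ} (hΦ : AEStronglyMeasurable Φ (μ.prod ν)) {M : ℝ} (hM : ∀ z, ‖Φ z‖ ≤ M) :
    ∫ z, cauchySnd ν F z * Φ z ∂(μ.prod ν)
      = ∫ b, ∫ ζ, (∫ x, F (x, ζ) * Φ (x, b) ∂μ) / (ζ - b) ∂ν ∂ν := by
  have hswap : MeasurePreserving (Prod.map Prod.swap id : (X × ℂ) × ℂ → (ℂ × X) × ℂ)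
      ((μ.prod ν).prod ν) ((ν.prod μ).prod ν) :=
    Measure.measurePreserving_swap.prod (MeasurePreserving.id ν)
  have hassoc := measurePreserving_prodAssoc μ ν ν
  have h_int : Integrable (fun q : (X × ℂ) × ℂ => F (q.1.1, q.2) / (q.2 - q.1.2) * Φ q.1)
      ((μ.prod ν).prod ν) :=
    (hswap.integrable_comp_of_integrable (integrable_cauchyFst_integrand hν hF.swap)).mul_bdd
      hΦ.comp_fst (.of_forall fun q => hM _)
  have h_int' : Integrable (fun q : X × ℂ × ℂ =>
      F (q.1, q.2.2) / (q.2.2 - q.2.1) * Φ (q.1, q.2.1)) (μ.prod (ν.prod ν)) :=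
    (hassoc.integrable_comp_emb MeasurableEquiv.prodAssoc.measurableEmbedding).1 h_int
  calc ∫ z, cauchySnd ν F z * Φ z ∂(μ.prod ν)
      = ∫ z, ∫ ζ, F (z.1, ζ) / (ζ - z.2) * Φ z ∂ν ∂(μ.prod ν) := by
        simp only [cauchySnd, integral_mul_const]
    _ = ∫ q, F (q.1.1, q.2) / (q.2 - q.1.2) * Φ q.1 ∂((μ.prod ν).prod ν) :=
        (integral_prod _ h_int).symm
    _ = ∫ q, F (q.1, q.2.2) / (q.2.2 - q.2.1) * Φ (q.1, q.2.1) ∂(μ.prod (ν.prod ν)) :=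
        hassoc.integral_comp MeasurableEquiv.prodAssoc.measurableEmbedding
          fun q => F (q.1, q.2.2) / (q.2.2 - q.2.1) * Φ (q.1, q.2.1)
    _ = ∫ w, ∫ x, F (x, w.2) / (w.2 - w.1) * Φ (x, w.1) ∂μ ∂(ν.prod ν) :=
        integral_prod_symm _ h_int'
    _ = ∫ b, ∫ ζ, ∫ x, F (x, ζ) / (ζ - b) * Φ (x, b) ∂μ ∂ν ∂ν :=
        integral_prod _ h_int'.integral_prod_right
    _ = ∫ b, ∫ ζ, (∫ x, F (x, ζ) * Φ (x, b) ∂μ) / (ζ - b) ∂ν ∂ν := by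
        simp only [← integral_div, div_mul_eq_mul_div]

end CauchySnd

/-! ### The double Cauchy transform -/

/-- The Cauchy transform in both variables at once, as an integral over the product. -/
def doubleCauchy (μ ν : Measure ℂ) (G : ℂ × ℂ → ℂ) (z : ℂ × ℂ) : ℂ :=
  ∫ ζ, G ζ / ((ζ.1 - z.1) * (ζ.2 - z.2)) ∂(μ.prod ν)

section DoubleCauchy

variable {μ ν : Measure ℂ} [SFinite μ] [SFinite ν] {G : ℂ × ℂ → ℂ}

lemma ae_integrable_doubleCauchy_integrand (hμ : cauchyMass μ ≠ ⊤) (hν : cauchyMass ν ≠ ⊤)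
    (hG : Integrable G (μ.prod ν)) :
    ∀ᵐ z ∂(μ.prod ν),
      Integrable (fun ζ => G ζ / ((ζ.1 - z.1) * (ζ.2 - z.2))) (μ.prod ν) := by
  have hmeas : AEStronglyMeasurable (fun q : (ℂ × ℂ) × ℂ × ℂ =>
      G q.1 / ((q.1.1 - q.2.1) * (q.1.2 - q.2.2))) ((μ.prod ν).prod (μ.prod ν)) := by
    simp only [div_eq_mul_inv]
    exact hG.1.comp_fst.mul (Measurable.aestronglyMeasurable (by fun_prop))
  have hkernel : ∀ ζ : ℂ × ℂ, ∫⁻ z, ‖G ζ / ((ζ.1 - z.1) * (ζ.2 - z.2))‖ₑ ∂(μ.prod ν) ≤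
      (cauchyMass μ * cauchyMass ν) * ‖G ζ‖ₑ := fun ζ => by
    simp only [div_eq_mul_inv, mul_inv, enorm_mul]
    rw [lintegral_const_mul _ (by fun_prop),
      lintegral_prod_mul (f := fun z => ‖(ζ.1 - z)⁻¹‖ₑ) (g := fun z => ‖(ζ.2 - z)⁻¹‖ₑ)
        (by fun_prop) (by fun_prop), mul_comm]
    gcongr <;> exact lintegral_enorm_inv_sub_le' _ _
  refine Integrable.prod_left_ae ⟨hmeas, ?_⟩
  rw [hasFiniteIntegral_iff_enorm, lintegral_prod _ hmeas.enorm]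
  refine (lintegral_mono hkernel).trans_lt ?_
  rw [lintegral_const_mul'' _ hG.1.enorm]
  exact ENNReal.mul_lt_top (ENNReal.mul_lt_top hμ.lt_top hν.lt_top) hG.2

lemma doubleCauchy_ae_eq (hμ : cauchyMass μ ≠ ⊤) (hν : cauchyMass ν ≠ ⊤)
    (hG : Integrable G (μ.prod ν)) :
    doubleCauchy μ ν G =ᵐ[μ.prod ν] cauchyFst μ (cauchySnd ν G) := by
  filter_upwards [ae_integrable_doubleCauchy_integrand hμ hν hG] with z hz
  rw [doubleCauchy, integral_prod _ hz]
  simp only [cauchyFst, cauchySnd, ← integral_div, div_div, mul_comm]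

lemma doubleCauchy_swap (G : ℂ × ℂ → ℂ) (z : ℂ × ℂ) :
    doubleCauchy ν μ (G ∘ Prod.swap) z = doubleCauchy μ ν G z.swap := by
  rw [doubleCauchy, doubleCauchy, ← integral_prod_swap]
  simp only [Function.comp_apply, Prod.swap_swap, Prod.fst_swap, Prod.snd_swap, mul_comm]

lemma aestronglyMeasurable_doubleCauchy (hμ : cauchyMass μ ≠ ⊤) (hν : cauchyMass ν ≠ ⊤)
    (hG : Integrable G (μ.prod ν)) :
    AEStronglyMeasurable (doubleCauchy μ ν G) (μ.prod ν) :=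
  (aestronglyMeasurable_cauchyFst (aestronglyMeasurable_cauchySnd hG.1)).congr
    (doubleCauchy_ae_eq hμ hν hG).symm

lemma eLpNorm_doubleCauchy_le (hμ : cauchyMass μ ≠ ⊤) (hν : cauchyMass ν ≠ ⊤) {p : ℝ≥0∞}
    (hp : 1 ≤ p) (hG : Integrable G (μ.prod ν)) :
    eLpNorm (doubleCauchy μ ν G) p (μ.prod ν) ≤
      cauchyMass μ * cauchyMass ν * eLpNorm G p (μ.prod ν) := by
  rw [eLpNorm_congr_ae (doubleCauchy_ae_eq hμ hν hG), mul_assoc]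
  refine (eLpNorm_cauchyFst_le hp (aestronglyMeasurable_cauchySnd hG.1)).trans ?_
  gcongr
  exact eLpNorm_cauchySnd_le hp hG.1

end DoubleCauchy

/-! ### Test functions on a product -/

section TestFunction

variable {D₁ D₂ : Set ℂ} {φ : ℂ × ℂ → ℂ}

lemma dbar₁_eq_dbar (hφ : Differentiable ℝ φ) (z w : ℂ) :
    dbar₁ φ (z, w) = dbar (fun z => φ (z, w)) z := by
  have h : HasFDerivAt (fun z => φ (z, w)) _ z :=
    (hφ (z, w)).hasFDerivAt.comp z (hasFDerivAt_prodMk_left z w)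
  rw [dbar, h.fderiv]
  rfl

lemma dbar₂_swap (hφ : Differentiable ℝ φ) (z : ℂ × ℂ) :
    dbar₂ φ z.swap = dbar₁ (φ ∘ Prod.swap) z := by
  have h : HasFDerivAt (φ ∘ Prod.swap) _ z :=
    (hφ z.swap).hasFDerivAt.comp z (ContinuousLinearEquiv.prodComm ℝ ℂ ℂ).hasFDerivAt
  rw [dbar₁, h.fderiv]
  rfl

lemma dbar_eq_zero_of_notMem_tsupport {ψ : ℂ → ℂ} {z : ℂ} (hz : z ∉ tsupport ψ) :
    dbar ψ z = 0 := by
  simp [dbar, fderiv_eq_zero_of_notMem_tsupport hz]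

lemma continuous_dbar {ψ : ℂ → ℂ} (hψ : ContDiff ℝ ∞ ψ) : Continuous (dbar ψ) := by
  have h : Continuous (fderiv ℝ ψ) := hψ.continuous_fderiv (by simp)
  unfold dbar
  fun_prop

namespace IsTestFunction

lemma differentiable {Ω : Set (ℂ × ℂ)} (hφ : IsTestFunction Ω φ) : Differentiable ℝ φ :=
  hφ.1.differentiable (by simp)

lemma continuous_dbar₁ {Ω : Set (ℂ × ℂ)} (hφ : IsTestFunction Ω φ) : Continuous (dbar₁ φ) := by
  have h : Continuous (fderiv ℝ φ) := hφ.1.continuous_fderiv (by simp)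
  unfold dbar₁
  fun_prop

lemma hasCompactSupport_dbar₁ {Ω : Set (ℂ × ℂ)} (hφ : IsTestFunction Ω φ) :
    HasCompactSupport (dbar₁ φ) :=
  HasCompactSupport.intro hφ.2.1 fun _ hz => by
    simp [dbar₁, fderiv_eq_zero_of_notMem_tsupport hz]

lemma integrableOn_mul {Ω Ω' : Set (ℂ × ℂ)} {u : ℂ × ℂ → ℂ} (hφ : IsTestFunction Ω φ)
    (hu : IntegrableOn u Ω') : IntegrableOn (fun z => u z * φ z) Ω' :=
  hu.integrable.locallyIntegrable.integrable_smul_right_of_hasCompactSupport hφ.1.continuous hφ.2.1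

lemma integrableOn_mul_dbar₁ {Ω Ω' : Set (ℂ × ℂ)} {u : ℂ × ℂ → ℂ} (hφ : IsTestFunction Ω φ)
    (hu : IntegrableOn u Ω') : IntegrableOn (fun z => u z * dbar₁ φ z) Ω' :=
  hu.integrable.locallyIntegrable.integrable_smul_right_of_hasCompactSupport hφ.continuous_dbar₁
    hφ.hasCompactSupport_dbar₁

lemma comp_swap (hφ : IsTestFunction (D₁ ×ˢ D₂) φ) :
    IsTestFunction (D₂ ×ˢ D₁) (φ ∘ Prod.swap) := by
  refine ⟨hφ.1.comp (contDiff_snd.prodMk contDiff_fst),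
    hφ.2.1.comp_homeomorph (Homeomorph.prodComm ℂ ℂ), fun z hz => ?_⟩
  have hswap : z.swap ∈ tsupport φ := tsupport_comp_subset_preimage φ continuous_swap hz
  exact (hφ.2.2 hswap).symm

lemma slice (hφ : IsTestFunction (D₁ ×ˢ D₂) φ) (w : ℂ) :
    ContDiff ℝ ∞ (fun z => φ (z, w)) ∧ HasCompactSupport (fun z => φ (z, w)) ∧
      tsupport (fun z => φ (z, w)) ⊆ D₁ := by
  have hsub : tsupport (fun z => φ (z, w)) ⊆ (fun z => (z, w)) ⁻¹' tsupport φ :=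
    tsupport_comp_subset_preimage φ (by fun_prop)
  refine ⟨hφ.1.comp (by fun_prop), ?_, fun z hz => (hφ.2.2 (hsub hz)).1⟩
  exact (hφ.2.1.image continuous_fst).of_isClosed_subset (isClosed_tsupport _)
    fun z hz => ⟨(z, w), hsub hz, rfl⟩

end IsTestFunction

lemma isTestFunction_mul {ψ η : ℂ → ℂ} (hψ : ContDiff ℝ ∞ ψ) (hψc : HasCompactSupport ψ)
    (hψs : tsupport ψ ⊆ D₁) (hη : ContDiff ℝ ∞ η) (hηc : HasCompactSupport η)
    (hηs : tsupport η ⊆ D₂) : IsTestFunction (D₁ ×ˢ D₂) fun z => ψ z.1 * η z.2 := by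
  have hsub : tsupport (fun z : ℂ × ℂ => ψ z.1 * η z.2) ⊆ tsupport ψ ×ˢ tsupport η := by
    refine closure_minimal (fun z hz => ?_) ((isClosed_tsupport _).prod (isClosed_tsupport _))
    rw [Function.mem_support, mul_ne_zero_iff] at hz
    exact ⟨subset_tsupport _ hz.1, subset_tsupport _ hz.2⟩
  exact ⟨(hψ.comp contDiff_fst).mul (hη.comp contDiff_snd),
    (hψc.isCompact.prod hηc.isCompact).of_isClosed_subset (isClosed_tsupport _) hsub,
    hsub.trans (prod_mono hψs hηs)⟩

lemma dbar₁_mul {ψ η : ℂ → ℂ} (hψ : Differentiable ℝ ψ) (hη : Differentiable ℝ η) (z : ℂ × ℂ) :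
    dbar₁ (fun z => ψ z.1 * η z.2) z = dbar ψ z.1 * η z.2 := by
  rw [← Prod.mk.eta (p := z), dbar₁_eq_dbar (by fun_prop), dbar, dbar,
    fderiv_mul_const (hψ z.1) (η z.2)]
  simp only [smul_apply, smul_eq_mul]
  ring

lemma setIntegral_dbar₁_div_sub (hφ : IsTestFunction (D₁ ×ˢ D₂) φ) (a b : ℂ) :
    ∫ z in D₁, dbar₁ φ (z, b) / (a - z) = π * φ (a, b) := by
  obtain ⟨hsmooth, hcompact, hsub⟩ := hφ.slice b
  simp only [dbar₁_eq_dbar hφ.differentiable]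
  rw [setIntegral_eq_integral_of_forall_compl_eq_zero fun z hz => by
    rw [dbar_eq_zero_of_notMem_tsupport fun h => hz (hsub h), zero_div]]
  exact integral_dbar_div_sub (hsmooth.of_le (by simp)) hcompact a

end TestFunction

/-! ### Weak derivatives -/

/-- `∂u/∂z̄₁ = g` weakly on `Ω`, for functions `u` and `g` that are integrable on all of `Ω`. -/
structure HasWeakDbar₁ (Ω : Set (ℂ × ℂ)) (u g : ℂ × ℂ → ℂ) : Prop where
  integrableOn : IntegrableOn u Ω
  integrableOn_deriv : IntegrableOn g Ω
  integral_mul_dbar₁ : ∀ φ, IsTestFunction Ω φ →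
    ∫ z in Ω, u z * dbar₁ φ z = -∫ z in Ω, g z * φ z

/-- `∂u/∂z̄₂ = g` weakly on `Ω`, for functions `u` and `g` that are integrable on all of `Ω`. -/
structure HasWeakDbar₂ (Ω : Set (ℂ × ℂ)) (u g : ℂ × ℂ → ℂ) : Prop where
  integrableOn : IntegrableOn u Ω
  integrableOn_deriv : IntegrableOn g Ω
  integral_mul_dbar₂ : ∀ φ, IsTestFunction Ω φ →
    ∫ z in Ω, u z * dbar₂ φ z = -∫ z in Ω, g z * φ z

lemma volume_restrict_prod (D₁ D₂ : Set ℂ) :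
    (volume.restrict (D₁ ×ˢ D₂) : Measure (ℂ × ℂ)) =
      (volume.restrict D₁).prod (volume.restrict D₂) :=
  (Measure.prod_restrict D₁ D₂).symm

namespace HasWeakDbar₁

variable {Ω : Set (ℂ × ℂ)} {u v g h : ℂ × ℂ → ℂ}

lemma congr_ae (hu : HasWeakDbar₁ Ω u g) (huv : u =ᵐ[volume.restrict Ω] v) :
    HasWeakDbar₁ Ω v g where
  integrableOn := hu.integrableOn.congr huv
  integrableOn_deriv := hu.integrableOn_deriv
  integral_mul_dbar₁ φ hφ := by
    rw [← hu.integral_mul_dbar₁ φ hφ]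
    exact integral_congr_ae (huv.symm.mul .rfl)

lemma add (hu : HasWeakDbar₁ Ω u g) (hv : HasWeakDbar₁ Ω v h) :
    HasWeakDbar₁ Ω (u + v) (g + h) where
  integrableOn := hu.integrableOn.add hv.integrableOn
  integrableOn_deriv := hu.integrableOn_deriv.add hv.integrableOn_deriv
  integral_mul_dbar₁ φ hφ := by
    simp only [Pi.add_apply, add_mul]
    rw [integral_add (hφ.integrableOn_mul_dbar₁ hu.integrableOn)
        (hφ.integrableOn_mul_dbar₁ hv.integrableOn),
      integral_add (hφ.integrableOn_mul hu.integrableOn_deriv)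
        (hφ.integrableOn_mul hv.integrableOn_deriv),
      hu.integral_mul_dbar₁ φ hφ, hv.integral_mul_dbar₁ φ hφ, neg_add]

lemma const_smul (hu : HasWeakDbar₁ Ω u g) (c : ℂ) : HasWeakDbar₁ Ω (c • u) (c • g) where
  integrableOn := hu.integrableOn.smul c
  integrableOn_deriv := hu.integrableOn_deriv.smul c
  integral_mul_dbar₁ φ hφ := by
    simp only [Pi.smul_apply, smul_mul_assoc, integral_smul, hu.integral_mul_dbar₁ φ hφ,
      smul_neg]

end HasWeakDbar₁

section Product

variable {D₁ D₂ : Set ℂ} {u g F : ℂ × ℂ → ℂ}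

lemma hasWeakDbar₂_iff_swap :
    HasWeakDbar₂ (D₁ ×ˢ D₂) u g ↔
      HasWeakDbar₁ (D₂ ×ˢ D₁) (u ∘ Prod.swap) (g ∘ Prod.swap) := by
  have hswap : ∀ k : ℂ × ℂ → ℂ, ∫ z in D₁ ×ˢ D₂, k z = ∫ z in D₂ ×ˢ D₁, k z.swap := fun k =>
    (setIntegral_prod_swap (μ := volume) (ν := volume) D₁ D₂ k).symm
  refine ⟨fun h => ⟨h.integrableOn.swap, h.integrableOn_deriv.swap, fun φ hφ => ?_⟩,
    fun h => ⟨h.integrableOn.swap, h.integrableOn_deriv.swap, fun φ hφ => ?_⟩⟩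
  · simpa only [hswap, dbar₂_swap hφ.comp_swap.differentiable, Function.comp_assoc,
      Function.comp_apply, Prod.swap_swap, Prod.swap_swap_eq, Function.comp_id] using
      h.integral_mul_dbar₂ _ hφ.comp_swap
  · simpa only [hswap, dbar₂_swap hφ.differentiable, Function.comp_apply] using
      h.integral_mul_dbar₁ _ hφ.comp_swap

lemma hasWeakDbar₁_cauchyFst (hD₁ : cauchyMass (volume.restrict D₁) ≠ ⊤)
    (hF : IntegrableOn F (D₁ ×ˢ D₂)) :
    HasWeakDbar₁ (D₁ ×ˢ D₂) (cauchyFst (volume.restrict D₁) F) ((-π : ℂ) • F) where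
  integrableOn := by
    rw [IntegrableOn, volume_restrict_prod] at hF ⊢
    exact integrable_cauchyFst hD₁ hF
  integrableOn_deriv := hF.smul _
  integral_mul_dbar₁ φ hφ := by
    have hdbar : cauchyFst (volume.restrict D₁) (dbar₁ φ) = (-π : ℂ) • φ := by
      funext ⟨a, b⟩
      simp only [cauchyFst, Pi.smul_apply, smul_eq_mul, neg_mul, ← setIntegral_dbar₁_div_sub hφ,
        ← integral_neg, ← div_neg, neg_sub]
    obtain ⟨M, hM⟩ := hφ.hasCompactSupport_dbar₁.exists_bound_of_continuous hφ.continuous_dbar₁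
    rw [IntegrableOn, volume_restrict_prod] at hF
    rw [volume_restrict_prod,
      integral_cauchyFst_mul hD₁ hF hφ.continuous_dbar₁.aestronglyMeasurable hM, hdbar]
    simp only [Pi.smul_apply, smul_mul_assoc, mul_smul_comm]

lemma ae_integral_slice_eq_zero {X : Type*} [MeasurableSpace X] {μ : Measure X} [SFinite μ]
    {D : Set ℂ} (hD : IsOpen D) {H : X × ℂ → ℂ} (hH : Integrable H (μ.prod (volume.restrict D)))
    (hη : ∀ η : ℂ → ℝ, ContDiff ℝ ∞ η → HasCompactSupport η → tsupport η ⊆ D →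
      ∫ z, H z * η z.2 ∂(μ.prod (volume.restrict D)) = 0) :
    ∀ᵐ ζ ∂volume.restrict D, ∫ x, H (x, ζ) ∂μ = 0 := by
  rw [ae_restrict_iff' hD.measurableSet]
  refine hD.ae_eq_zero_of_integral_contDiff_smul_eq_zero
    (IntegrableOn.locallyIntegrableOn hH.integral_prod_right) fun η hsmooth hcompact hsub => ?_
  obtain ⟨M, hM⟩ := hcompact.exists_bound_of_continuous hsmooth.continuous
  have hcont : Continuous fun ζ => (η ζ : ℂ) := by fun_prop
  have h_int : Integrable (fun z => H z * η z.2) (μ.prod (volume.restrict D)) :=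
    hH.mul_bdd (hcont.measurable.comp measurable_snd).aestronglyMeasurable
      (.of_forall fun z => by simpa using hM z.2)
  rw [← setIntegral_eq_integral_of_forall_compl_eq_zero fun ζ hζ => by
    rw [image_eq_zero_of_notMem_tsupport fun h => hζ (hsub h), zero_smul]]
  calc ∫ ζ in D, η ζ • ∫ x, H (x, ζ) ∂μ
      = ∫ ζ in D, ∫ x, H (x, ζ) * η ζ ∂μ := by
        simp only [integral_mul_const, Complex.real_smul, mul_comm (Complex.ofReal _)]
    _ = ∫ z, H z * η z.2 ∂(μ.prod (volume.restrict D)) := (integral_prod_symm _ h_int).symm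
    _ = 0 := hη η hsmooth hcompact hsub

lemma HasWeakDbar₁.ae_slice (hD₂ : IsOpen D₂) (hu : HasWeakDbar₁ (D₁ ×ˢ D₂) u g) {ψ : ℂ → ℂ}
    (hψ : ContDiff ℝ ∞ ψ) (hψc : HasCompactSupport ψ) (hψs : tsupport ψ ⊆ D₁) :
    ∀ᵐ ζ ∂volume.restrict D₂, ∫ z in D₁, u (z, ζ) * dbar ψ z = -∫ z in D₁, g (z, ζ) * ψ z := by
  have hmul {w : ℂ × ℂ → ℂ} {k : ℂ → ℂ} (hw : IntegrableOn w (D₁ ×ˢ D₂)) (hk : Continuous k)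
      (hkc : HasCompactSupport k) :
      Integrable (fun z => w z * k z.1) ((volume.restrict D₁).prod (volume.restrict D₂)) := by
    obtain ⟨M, hM⟩ := hkc.exists_bound_of_continuous hk
    rw [IntegrableOn, volume_restrict_prod] at hw
    exact hw.mul_bdd (by fun_prop) (.of_forall fun z => hM z.1)
  have hdbar := hmul hu.integrableOn (continuous_dbar hψ)
    (.intro hψc fun _ hz => dbar_eq_zero_of_notMem_tsupport hz)
  have htest := hmul hu.integrableOn_deriv hψ.continuous hψc
  have hzero := ae_integral_slice_eq_zero hD₂ (hdbar.add htest) fun η hη hηc hηs => by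
    have hη' : ContDiff ℝ ∞ fun ζ => (η ζ : ℂ) := Complex.ofRealCLM.contDiff.comp hη
    have hφ := isTestFunction_mul hψ hψc hψs hη' (hηc.comp_left Complex.ofReal_zero)
      ((tsupport_comp_subset Complex.ofReal_zero η).trans hηs)
    have hweak := hu.integral_mul_dbar₁ _ hφ
    rw [eq_neg_iff_add_eq_zero, ← integral_add (hφ.integrableOn_mul_dbar₁ hu.integrableOn)
      (hφ.integrableOn_mul hu.integrableOn_deriv), volume_restrict_prod] at hweak
    rw [← hweak]
    simp only [dbar₁_mul (hψ.differentiable (by simp)) (hη'.differentiable (by simp)),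
      Pi.add_apply, add_mul, mul_assoc]
  filter_upwards [hzero, hdbar.prod_left_ae, htest.prod_left_ae] with ζ hζ h₁ h₂
  rw [eq_neg_iff_add_eq_zero, ← integral_add h₁ h₂]
  exact hζ

lemma HasWeakDbar₁.cauchySnd (hν : cauchyMass (volume.restrict D₂) ≠ ⊤) (hD₂ : IsOpen D₂)
    (hu : HasWeakDbar₁ (D₁ ×ˢ D₂) u g) :
    HasWeakDbar₁ (D₁ ×ˢ D₂) (cauchySnd (volume.restrict D₂) u)
      (cauchySnd (volume.restrict D₂) g) := by
  have hslice {φ} (hφ : IsTestFunction (D₁ ×ˢ D₂) φ) (b : ℂ) :=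
    hu.ae_slice hD₂ (hφ.slice b).1 (hφ.slice b).2.1 (hφ.slice b).2.2
  obtain ⟨hi, hi', -⟩ := hu
  rw [IntegrableOn, volume_restrict_prod] at hi hi'
  refine ⟨?_, ?_, fun φ hφ => ?_⟩
  · rw [IntegrableOn, volume_restrict_prod]
    exact integrable_cauchySnd hν hi
  · rw [IntegrableOn, volume_restrict_prod]
    exact integrable_cauchySnd hν hi'
  obtain ⟨M, hM⟩ := hφ.2.1.exists_bound_of_continuous hφ.1.continuous
  obtain ⟨M', hM'⟩ := hφ.hasCompactSupport_dbar₁.exists_bound_of_continuous hφ.continuous_dbar₁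
  rw [volume_restrict_prod,
    integral_cauchySnd_mul hν hi hφ.continuous_dbar₁.aestronglyMeasurable hM',
    integral_cauchySnd_mul hν hi' hφ.1.continuous.aestronglyMeasurable hM, ← integral_neg]
  congr with b
  rw [← integral_neg]
  refine integral_congr_ae ?_
  filter_upwards [hslice hφ b] with ζ hζ
  simp only [dbar₁_eq_dbar hφ.differentiable]
  rw [hζ, neg_div]

end Product

/-! ### The solution operator -/

/-- The solution operator `T` for arbitrary measures `μ` and `ν` on the two factors, with `G` in the
place of `𝒟(f)` and with `dζ̄ ∧ dζ = 2i dA` expressed by the area measure. -/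
def cauchySol (μ ν : Measure ℂ) (F₁ F₂ G : ℂ × ℂ → ℂ) : ℂ × ℂ → ℂ :=
  (-(1 / π) : ℂ) • (cauchySnd ν F₂ + cauchyFst μ F₁ + (1 / π : ℂ) • doubleCauchy μ ν G)

lemma solT_eq_cauchySol (D₁ D₂ : Set ℂ) (f : Form01) :
    solT D₁ D₂ f = cauchySol (volume.restrict D₁) (volume.restrict D₂) f.f₁ f.f₂
      (scriptD (D₁ ×ˢ D₂) f) := by
  have hpi : (π : ℂ) ≠ 0 := Complex.ofReal_ne_zero.2 Real.pi_ne_zero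
  funext z
  simp only [solT, cauchySol, cauchySnd, cauchyFst, doubleCauchy, volume_restrict_prod,
    Pi.smul_apply, Pi.add_apply, smul_eq_mul]
  field_simp
  ring

section CauchySol

variable {μ ν : Measure ℂ} [SFinite μ] [SFinite ν] {F₁ F₂ G : ℂ × ℂ → ℂ}

lemma cauchySol_swap (F₁ F₂ G : ℂ × ℂ → ℂ) :
    cauchySol ν μ (F₂ ∘ Prod.swap) (F₁ ∘ Prod.swap) (G ∘ Prod.swap) =
      cauchySol μ ν F₁ F₂ G ∘ Prod.swap := by
  funext z
  simp only [cauchySol, Pi.smul_apply, Pi.add_apply, Function.comp_apply, doubleCauchy_swap]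
  rw [add_comm (cauchySnd μ _ z)]
  rfl

lemma cauchySol_congr_ae {F₁' F₂' : ℂ × ℂ → ℂ} (h₁ : F₁ =ᵐ[μ.prod ν] F₁')
    (h₂ : F₂ =ᵐ[μ.prod ν] F₂') (G : ℂ × ℂ → ℂ) :
    cauchySol μ ν F₁ F₂ G =ᵐ[μ.prod ν] cauchySol μ ν F₁' F₂' G :=
  (((cauchySnd_congr_ae h₂).add (cauchyFst_congr_ae h₁)).add .rfl).const_smul _

lemma aestronglyMeasurable_cauchySol (hμ : cauchyMass μ ≠ ⊤) (hν : cauchyMass ν ≠ ⊤)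
    (hF₁ : AEStronglyMeasurable F₁ (μ.prod ν)) (hF₂ : AEStronglyMeasurable F₂ (μ.prod ν))
    (hG : Integrable G (μ.prod ν)) :
    AEStronglyMeasurable (cauchySol μ ν F₁ F₂ G) (μ.prod ν) :=
  (((aestronglyMeasurable_cauchySnd hF₂).add (aestronglyMeasurable_cauchyFst hF₁)).add
    ((aestronglyMeasurable_doubleCauchy hμ hν hG).const_smul _)).const_smul _

lemma enorm_one_div_pi_le_one : ‖(1 / π : ℂ)‖ₑ ≤ 1 := by
  rw [← ofReal_norm, ENNReal.ofReal_le_one, norm_div, norm_one, Complex.norm_real,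
    Real.norm_of_nonneg Real.pi_pos.le]
  exact div_le_one_of_le₀ (by linarith [Real.pi_gt_three]) Real.pi_pos.le

lemma eLpNorm_cauchySol_le (hμ : cauchyMass μ ≠ ⊤) (hν : cauchyMass ν ≠ ⊤) {p : ℝ≥0∞}
    (hp : 1 ≤ p) (hF₁ : AEStronglyMeasurable F₁ (μ.prod ν))
    (hF₂ : AEStronglyMeasurable F₂ (μ.prod ν)) (hG : Integrable G (μ.prod ν)) :
    eLpNorm (cauchySol μ ν F₁ F₂ G) p (μ.prod ν) ≤
      (cauchyMass μ + cauchyMass ν + cauchyMass μ * cauchyMass ν) *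
        (eLpNorm F₁ p (μ.prod ν) + eLpNorm F₂ p (μ.prod ν) + eLpNorm G p (μ.prod ν)) := by
  have hm₁ := aestronglyMeasurable_cauchyFst hF₁
  have hm₂ := aestronglyMeasurable_cauchySnd hF₂
  have hm := (aestronglyMeasurable_doubleCauchy hμ hν hG).const_smul (1 / π : ℂ)
  set A := cauchyMass μ
  set B := cauchyMass ν
  calc eLpNorm (cauchySol μ ν F₁ F₂ G) p (μ.prod ν)
      ≤ 1 * eLpNorm (cauchySnd ν F₂ + cauchyFst μ F₁ + (1 / π : ℂ) • doubleCauchy μ ν G) p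
          (μ.prod ν) := by
        rw [cauchySol, eLpNorm_const_smul, enorm_neg]
        gcongr
        exact enorm_one_div_pi_le_one
    _ ≤ eLpNorm (cauchySnd ν F₂) p (μ.prod ν) + eLpNorm (cauchyFst μ F₁) p (μ.prod ν) +
          1 * eLpNorm (doubleCauchy μ ν G) p (μ.prod ν) := by
        rw [one_mul]
        refine (eLpNorm_add_le (hm₂.add hm₁) hm hp).trans
          (add_le_add (eLpNorm_add_le hm₂ hm₁ hp) ?_)
        rw [eLpNorm_const_smul]
        gcongr
        exact enorm_one_div_pi_le_one
    _ ≤ B * eLpNorm F₂ p (μ.prod ν) + A * eLpNorm F₁ p (μ.prod ν) +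
          A * B * eLpNorm G p (μ.prod ν) := by
        rw [one_mul]
        gcongr
        exacts [eLpNorm_cauchySnd_le hp hF₂, eLpNorm_cauchyFst_le hp hF₁,
          eLpNorm_doubleCauchy_le hμ hν hp hG]
    _ ≤ (A + B + A * B) * eLpNorm F₂ p (μ.prod ν) + (A + B + A * B) * eLpNorm F₁ p (μ.prod ν) +
          (A + B + A * B) * eLpNorm G p (μ.prod ν) := by
        gcongr
        exacts [le_add_self.trans le_self_add, le_self_add.trans le_self_add, le_add_self]
    _ = _ := by ring

end CauchySol

section WeakSolution

variable {D₁ D₂ : Set ℂ} {F₁ F₂ G : ℂ × ℂ → ℂ}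

lemma hasWeakDbar₁_cauchySol (hμ : cauchyMass (volume.restrict D₁) ≠ ⊤)
    (hν : cauchyMass (volume.restrict D₂) ≠ ⊤) (hD₂ : IsOpen D₂)
    (hF₁ : IntegrableOn F₁ (D₁ ×ˢ D₂)) (hF₂ : HasWeakDbar₁ (D₁ ×ˢ D₂) F₂ G) :
    HasWeakDbar₁ (D₁ ×ˢ D₂) (cauchySol (volume.restrict D₁) (volume.restrict D₂) F₁ F₂ G) F₁ := by
  have hpi : (π : ℂ) ≠ 0 := Complex.ofReal_ne_zero.2 Real.pi_ne_zero
  have hSnd := hF₂.cauchySnd hν hD₂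
  have hDouble : HasWeakDbar₁ (D₁ ×ˢ D₂)
      (doubleCauchy (volume.restrict D₁) (volume.restrict D₂) G)
      ((-π : ℂ) • cauchySnd (volume.restrict D₂) G) := by
    refine (hasWeakDbar₁_cauchyFst hμ hSnd.integrableOn_deriv).congr_ae ?_
    have hG := hF₂.integrableOn_deriv
    rw [IntegrableOn, volume_restrict_prod] at hG
    rw [volume_restrict_prod]
    exact (doubleCauchy_ae_eq hμ hν hG).symm
  have hsum := ((hSnd.add (hasWeakDbar₁_cauchyFst hμ hF₁)).add
    (hDouble.const_smul (1 / π))).const_smul (-(1 / π))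
  have hF₁_eq : (-(1 / π) : ℂ) • (cauchySnd (volume.restrict D₂) G + (-π : ℂ) • F₁ +
      (1 / π : ℂ) • (-π : ℂ) • cauchySnd (volume.restrict D₂) G) = F₁ := by
    funext z
    simp only [Pi.smul_apply, Pi.add_apply, smul_eq_mul]
    field_simp
    ring
  rwa [hF₁_eq] at hsum

lemma hasWeakDbar₂_cauchySol (hμ : cauchyMass (volume.restrict D₁) ≠ ⊤)
    (hν : cauchyMass (volume.restrict D₂) ≠ ⊤) (hD₁ : IsOpen D₁)
    (hF₁ : HasWeakDbar₂ (D₁ ×ˢ D₂) F₁ G) (hF₂ : IntegrableOn F₂ (D₁ ×ˢ D₂)) :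
    HasWeakDbar₂ (D₁ ×ˢ D₂) (cauchySol (volume.restrict D₁) (volume.restrict D₂) F₁ F₂ G) F₂ := by
  rw [hasWeakDbar₂_iff_swap] at hF₁ ⊢
  rw [← cauchySol_swap]
  exact hasWeakDbar₁_cauchySol hν hμ hD₁ hF₂.swap hF₁

end WeakSolution

/-! ### Forms -/

section Forms

variable {Ω : Set (ℂ × ℂ)} {f f' : Form01} {g : ℂ × ℂ → ℂ} {p : ℝ≥0∞}

lemma locallyIntegrableOn_congr_ae {u v : ℂ × ℂ → ℂ} (h : u =ᵐ[volume.restrict Ω] v) :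
    LocallyIntegrableOn u Ω ↔ LocallyIntegrableOn v Ω := by
  suffices himp : ∀ {u v : ℂ × ℂ → ℂ}, u =ᵐ[volume.restrict Ω] v →
      LocallyIntegrableOn u Ω → LocallyIntegrableOn v Ω from ⟨himp h, himp h.symm⟩
  intro u v h hu x hx
  obtain ⟨s, hs, hus⟩ := hu x hx
  exact ⟨s ∩ Ω, Filter.inter_mem hs self_mem_nhdsWithin,
    (hus.mono_set inter_subset_left).congr_fun_ae
      (ae_restrict_of_ae_restrict_of_subset inter_subset_right h)⟩

lemma scriptD_congr_ae (h₁ : f.f₁ =ᵐ[volume.restrict Ω] f'.f₁)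
    (h₂ : f.f₂ =ᵐ[volume.restrict Ω] f'.f₂) : scriptD Ω f = scriptD Ω f' := by
  have hscriptD : IsScriptD Ω f = IsScriptD Ω f' := by
    have h_int₁ (k : ℂ × ℂ → ℂ) : ∫ z in Ω, f.f₁ z * k z = ∫ z in Ω, f'.f₁ z * k z :=
      integral_congr_ae (h₁.mul .rfl)
    have h_int₂ (k : ℂ × ℂ → ℂ) : ∫ z in Ω, f.f₂ z * k z = ∫ z in Ω, f'.f₂ z * k z :=
      integral_congr_ae (h₂.mul .rfl)
    funext g
    simp only [IsScriptD, Form01.LocIntegrableOn, locallyIntegrableOn_congr_ae h₁,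
      locallyIntegrableOn_congr_ae h₂, h_int₁, h_int₂]
  rw [scriptD, scriptD, hscriptD]

lemma MemB.isScriptD (hf : MemB p Ω f) : IsScriptD Ω f (scriptD Ω f) :=
  have ⟨g, hg, _⟩ := hf.2.2
  isScriptD_scriptD ⟨g, hg⟩

lemma MemB.memLp_scriptD (hΩ : IsOpen Ω) (hf : MemB p Ω f) :
    MemLp (scriptD Ω f) p (volume.restrict Ω) :=
  have ⟨_, hg, hgp⟩ := hf.2.2
  hgp.ae_eq (hg.ae_eq hΩ hf.isScriptD)

lemma MemB.normB_lt_top (hΩ : IsOpen Ω) (hf : MemB p Ω f) : normB p Ω f < ⊤ :=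
  ENNReal.add_lt_top.2 ⟨ENNReal.add_lt_top.2 ⟨hf.1.2, hf.2.1.2⟩, (hf.memLp_scriptD hΩ).2⟩

lemma IsWeaklyDbarClosed.hasWeakDbar₁ (hcl : IsWeaklyDbarClosed Ω f) (hg : IsScriptD Ω f g)
    (hf₂ : IntegrableOn f.f₂ Ω) (hgi : IntegrableOn g Ω) : HasWeakDbar₁ Ω f.f₂ g :=
  ⟨hf₂, hgi, fun φ hφ => by rw [hg.2.2 φ hφ, hcl.2 φ hφ]; ring⟩

lemma IsWeaklyDbarClosed.hasWeakDbar₂ (hcl : IsWeaklyDbarClosed Ω f) (hg : IsScriptD Ω f g)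
    (hf₁ : IntegrableOn f.f₁ Ω) (hgi : IntegrableOn g Ω) : HasWeakDbar₂ Ω f.f₁ g :=
  ⟨hf₁, hgi, fun φ hφ => by rw [hg.2.2 φ hφ, hcl.2 φ hφ]; ring⟩

lemma integrableOn_of_memLp (hΩ : volume Ω ≠ ⊤) (hp : 1 ≤ p) {u : ℂ × ℂ → ℂ}
    (hu : MemLp u p (volume.restrict Ω)) : IntegrableOn u Ω :=
  have : IsFiniteMeasure (volume.restrict Ω) := isFiniteMeasure_restrict.2 hΩ
  hu.integrable hp

end Forms

section SolT

variable {D₁ D₂ : Set ℂ} {f f' : Form01} {p : ℝ≥0∞}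

lemma volume_prod_ne_top (hv₁ : volume D₁ ≠ ⊤) (hv₂ : volume D₂ ≠ ⊤) :
    volume (D₁ ×ˢ D₂) ≠ ⊤ := by
  rw [Measure.volume_eq_prod, Measure.prod_prod]
  exact ENNReal.mul_ne_top hv₁ hv₂

lemma solT_congr_ae (h₁ : f.f₁ =ᵐ[volume.restrict (D₁ ×ˢ D₂)] f'.f₁)
    (h₂ : f.f₂ =ᵐ[volume.restrict (D₁ ×ˢ D₂)] f'.f₂) :
    solT D₁ D₂ f =ᵐ[volume.restrict (D₁ ×ˢ D₂)] solT D₁ D₂ f' := by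
  rw [solT_eq_cauchySol, solT_eq_cauchySol, scriptD_congr_ae h₁ h₂]
  rw [volume_restrict_prod] at h₁ h₂ ⊢
  exact cauchySol_congr_ae h₁ h₂ _

lemma ae_solTConvergesAt (hD₁ : IsOpen D₁) (hD₂ : IsOpen D₂) (hv₁ : volume D₁ ≠ ⊤)
    (hv₂ : volume D₂ ≠ ⊤) (hp : 1 ≤ p) (hf : MemB p (D₁ ×ˢ D₂) f) :
    ∀ᵐ z ∂volume.restrict (D₁ ×ˢ D₂), SolTConvergesAt D₁ D₂ f z := by
  have hv := volume_prod_ne_top hv₁ hv₂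
  have hμ := cauchyMass_restrict_ne_top hv₁
  have hν := cauchyMass_restrict_ne_top hv₂
  have h₁ := integrableOn_of_memLp hv hp hf.1
  have h₂ := integrableOn_of_memLp hv hp hf.2.1
  have h := integrableOn_of_memLp hv hp (hf.memLp_scriptD (hD₁.prod hD₂))
  simp only [SolTConvergesAt, IntegrableOn, volume_restrict_prod] at h₁ h₂ h ⊢
  exact (ae_integrable_cauchySnd_integrand hν h₂).and
    ((ae_integrable_cauchyFst_integrand hμ h₁).and (ae_integrable_doubleCauchy_integrand hμ hν h))

lemma eLpNorm_solT_le (hD₁ : IsOpen D₁) (hD₂ : IsOpen D₂) (hv₁ : volume D₁ ≠ ⊤)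
    (hv₂ : volume D₂ ≠ ⊤) (hp : 1 ≤ p) (hf : MemB p (D₁ ×ˢ D₂) f) :
    eLpNorm (solT D₁ D₂ f) p (volume.restrict (D₁ ×ˢ D₂)) ≤
      (cauchyMass (volume.restrict D₁) + cauchyMass (volume.restrict D₂) +
        cauchyMass (volume.restrict D₁) * cauchyMass (volume.restrict D₂)) *
          normB p (D₁ ×ˢ D₂) f := by
  have h := integrableOn_of_memLp (volume_prod_ne_top hv₁ hv₂) hp
    (hf.memLp_scriptD (hD₁.prod hD₂))
  have h₁ := hf.1.1
  have h₂ := hf.2.1.1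
  rw [solT_eq_cauchySol, normB]
  simp only [IntegrableOn, volume_restrict_prod] at h h₁ h₂ ⊢
  exact eLpNorm_cauchySol_le (cauchyMass_restrict_ne_top hv₁) (cauchyMass_restrict_ne_top hv₂) hp
    h₁ h₂ h

lemma memLp_solT (hD₁ : IsOpen D₁) (hD₂ : IsOpen D₂) (hv₁ : volume D₁ ≠ ⊤)
    (hv₂ : volume D₂ ≠ ⊤) (hp : 1 ≤ p) (hf : MemB p (D₁ ×ˢ D₂) f) :
    MemLp (solT D₁ D₂ f) p (volume.restrict (D₁ ×ˢ D₂)) := by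
  have hμ := cauchyMass_restrict_ne_top hv₁
  have hν := cauchyMass_restrict_ne_top hv₂
  refine ⟨?_, (eLpNorm_solT_le hD₁ hD₂ hv₁ hv₂ hp hf).trans_lt
    (ENNReal.mul_lt_top (by finiteness) (hf.normB_lt_top (hD₁.prod hD₂)))⟩
  have h := integrableOn_of_memLp (volume_prod_ne_top hv₁ hv₂) hp
    (hf.memLp_scriptD (hD₁.prod hD₂))
  have h₁ := hf.1.1
  have h₂ := hf.2.1.1
  rw [solT_eq_cauchySol]
  simp only [IntegrableOn, volume_restrict_prod] at h h₁ h₂ ⊢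
  exact aestronglyMeasurable_cauchySol hμ hν h₁ h₂ h

lemma isWeakDbarSolution_solT (hD₁ : IsOpen D₁) (hD₂ : IsOpen D₂) (hv₁ : volume D₁ ≠ ⊤)
    (hv₂ : volume D₂ ≠ ⊤) (hp : 1 ≤ p) (hcl : IsWeaklyDbarClosed (D₁ ×ˢ D₂) f)
    (hf : MemB p (D₁ ×ˢ D₂) f) :
    IsWeakDbarSolution (D₁ ×ˢ D₂) (solT D₁ D₂ f) f := by
  have hv := volume_prod_ne_top hv₁ hv₂
  have hμ := cauchyMass_restrict_ne_top hv₁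
  have hν := cauchyMass_restrict_ne_top hv₂
  have h₁ := integrableOn_of_memLp hv hp hf.1
  have h₂ := integrableOn_of_memLp hv hp hf.2.1
  have h := integrableOn_of_memLp hv hp (hf.memLp_scriptD (hD₁.prod hD₂))
  have hdbar₁ := hasWeakDbar₁_cauchySol hμ hν hD₂ h₁ (hcl.hasWeakDbar₁ hf.isScriptD h₂ h)
  have hdbar₂ := hasWeakDbar₂_cauchySol hμ hν hD₁ (hcl.hasWeakDbar₂ hf.isScriptD h₁ h) h₂
  rw [← solT_eq_cauchySol] at hdbar₁ hdbar₂
  exact ⟨hdbar₁.integrableOn.locallyIntegrableOn, hcl.1, fun φ hφ =>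
    ⟨hdbar₁.integral_mul_dbar₁ φ hφ, hdbar₂.integral_mul_dbar₂ φ hφ⟩⟩

end SolT

lemma disc_eq_ball : disc = Metric.ball 0 1 := by
  ext z
  simp [disc]

lemma puncturedDisc_eq_ball_sdiff : puncturedDisc = Metric.ball 0 1 \ {0} := by
  ext z
  simp [puncturedDisc, and_comm]

lemma isOpen_disc : IsOpen disc :=
  disc_eq_ball ▸ Metric.isOpen_ball

lemma isOpen_puncturedDisc : IsOpen puncturedDisc :=
  puncturedDisc_eq_ball_sdiff ▸ Metric.isOpen_ball.sdiff isClosed_singleton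

lemma volume_disc_ne_top : volume disc ≠ ⊤ :=
  disc_eq_ball ▸ measure_ball_lt_top.ne

lemma volume_puncturedDisc_ne_top : volume puncturedDisc ≠ ⊤ :=
  measure_ne_top_of_subset (fun _ hz => hz.2) volume_disc_ne_top

end DbarProduct

end

open DbarProduct in
theorem corollary3p5_general {D₁ D₂ : Set ℂ} (hD₁ : IsOpen D₁) (hD₂ : IsOpen D₂)
    (hv₁ : volume D₁ ≠ ⊤) (hv₂ : volume D₂ ≠ ⊤) :
    ∃ C : ℝ, 0 < C ∧ ∀ (p : ℝ≥0∞) (f : Form01), 1 ≤ p → IsWeaklyDbarClosed (D₁ ×ˢ D₂) f →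
      MemB p (D₁ ×ˢ D₂) f →
        (∀ᵐ z ∂volume.restrict (D₁ ×ˢ D₂), SolTConvergesAt D₁ D₂ f z) ∧
        (∀ f' : Form01, f'.f₁ =ᵐ[volume.restrict (D₁ ×ˢ D₂)] f.f₁ →
          f'.f₂ =ᵐ[volume.restrict (D₁ ×ˢ D₂)] f.f₂ →
          solT D₁ D₂ f' =ᵐ[volume.restrict (D₁ ×ˢ D₂)] solT D₁ D₂ f) ∧
        IsWeakDbarSolution (D₁ ×ˢ D₂) (solT D₁ D₂ f) f ∧
        MemLp (solT D₁ D₂ f) p (volume.restrict (D₁ ×ˢ D₂)) ∧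
        eLpNorm (solT D₁ D₂ f) p (volume.restrict (D₁ ×ˢ D₂)) ≤
          ENNReal.ofReal C * normB p (D₁ ×ˢ D₂) f := by
  have hμ := cauchyMass_restrict_ne_top hv₁
  have hν := cauchyMass_restrict_ne_top hv₂
  set A := cauchyMass (volume.restrict D₁)
  set B := cauchyMass (volume.restrict D₂)
  refine ⟨(A + B + A * B).toReal + 1, by positivity, fun p f hp hcl hf =>
    ⟨ae_solTConvergesAt hD₁ hD₂ hv₁ hv₂ hp hf, fun f' => solT_congr_ae,
      isWeakDbarSolution_solT hD₁ hD₂ hv₁ hv₂ hp hcl hf, memLp_solT hD₁ hD₂ hv₁ hv₂ hp hf,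
      (eLpNorm_solT_le hD₁ hD₂ hv₁ hv₂ hp hf).trans ?_⟩⟩
  gcongr
  rw [ENNReal.ofReal_add ENNReal.toReal_nonneg zero_le_one,
    ENNReal.ofReal_toReal (by finiteness)]
  exact le_self_add

theorem corollary3p5 (p : ℝ≥0∞) (hp : 1 ≤ p) (hp' : p ≠ ⊤) :
    ∃ C : ℝ, 0 < C ∧ ∀ f : DbarProduct.Form01,
      DbarProduct.IsWeaklyDbarClosed (DbarProduct.disc ×ˢ DbarProduct.puncturedDisc) f →
      DbarProduct.MemB p (DbarProduct.disc ×ˢ DbarProduct.puncturedDisc) f →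
        -- `Tf` is well defined: the integrals converge absolutely almost everywhere,
        (∀ᵐ z ∂(volume.restrict (DbarProduct.disc ×ˢ DbarProduct.puncturedDisc)),
          DbarProduct.SolTConvergesAt DbarProduct.disc DbarProduct.puncturedDisc f z) ∧
        -- and, up to null sets, `Tf` depends only on the classes of `f₁` and `f₂`
        (∀ f' : DbarProduct.Form01,
          f'.f₁ =ᵐ[volume.restrict (DbarProduct.disc ×ˢ DbarProduct.puncturedDisc)] f.f₁ →
          f'.f₂ =ᵐ[volume.restrict (DbarProduct.disc ×ˢ DbarProduct.puncturedDisc)] f.f₂ →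
          DbarProduct.solT DbarProduct.disc DbarProduct.puncturedDisc f'
            =ᵐ[volume.restrict (DbarProduct.disc ×ˢ DbarProduct.puncturedDisc)]
          DbarProduct.solT DbarProduct.disc DbarProduct.puncturedDisc f) ∧
        DbarProduct.IsWeakDbarSolution (DbarProduct.disc ×ˢ DbarProduct.puncturedDisc)
          (DbarProduct.solT DbarProduct.disc DbarProduct.puncturedDisc f) f ∧
        MemLp (DbarProduct.solT DbarProduct.disc DbarProduct.puncturedDisc f) p
          (volume.restrict (DbarProduct.disc ×ˢ DbarProduct.puncturedDisc)) ∧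
        eLpNorm (DbarProduct.solT DbarProduct.disc DbarProduct.puncturedDisc f) p
            (volume.restrict (DbarProduct.disc ×ˢ DbarProduct.puncturedDisc)) ≤
          ENNReal.ofReal C *
            DbarProduct.normB p (DbarProduct.disc ×ˢ DbarProduct.puncturedDisc) f := by
  obtain ⟨C, hC, h⟩ := corollary3p5_general DbarProduct.isOpen_disc
    DbarProduct.isOpen_puncturedDisc DbarProduct.volume_disc_ne_top
    DbarProduct.volume_puncturedDisc_ne_top
  exact ⟨C, hC, fun f => h p f hp⟩
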